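/- Let $K$ be an algebraically closed field of characteristic zero, $\ell$ a finite dimensional Lie algebra over $K$ with basis $\{u\}$ and dual basis $\{u'\}$ of $\ell'=\mathrm{Hom}(\ell,K)$, and $\tilde\ell=\ell\otimes K[t,t^{-1}]$ its loop algebra, with restricted dual $\tilde\ell'=\bigoplus_n\mathrm{Hom}(\ell\otimes Kt^{-n},K)$. Consider the Clifford algebra generated by symbols $b_n^u,c_n^{u'}$ and the Weyl algebra generated by symbols $\beta_n^u,\gamma_n^{u'}$ ($n\in\mathbb Z$; each symbol linear in its upper index), with relations $$c_n^{u'}b_m^v+b_m^vc_n^{u'}=\langle u',v\rangle\delta_{m+n,0},\qquad \gamma_n^{u'}\beta_m^v-\beta_m^v\gamma_n^{u'}=\langle u',v\rangle\delta_{m+n,0},$$ the $b$'s anticommuting among themselves, the $c$'s anticommuting among themselves, the $\beta$'s commuting among themselves and the $\gamma$'s commuting among themselves. Call $b_n^u,\beta_n^u$ with $n\le -1$ and $c_n^{u'},\gamma_n^{u'}$ with $n\le 0$ creation operators, and the other generators annihilation operators. Let $S^{\infty/2}\tilde\ell'$ and $\wedge^{\infty/2}\tilde\ell'$ be the Weyl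 and Clifford modules induced from the trivial one-dimensional representations of the subalgebras generated by the annihilation operators, with generating vectors $\mathbf 1_{sym}$ and $\mathbf 1_{ext}$. The semi-infinite Weil complex is $W^{\infty/2}\tilde\ell=S^{\infty/2}\tilde\ell'\otimes\wedge^{\infty/2}\tilde\ell'$, with vacuum $\mathbf 1=\mathbf 1_{sym}\otimes\mathbf 1_{ext}$. Define on it the (locally finite) operators $$Q=\sum_{u,v;\,i,j}:\beta_{i+j}^{[u,v]}\gamma_{-i}^{v'}c_{-j}^{u'}:+\frac12\sum_{u,v;\,i,j}:b_{i+j}^{[u,v]}c_{-i}^{v'}c_{-j}^{u'}:\,,\qquad h=\sum_{u,n}\gamma_{-n}^{u'}b_n^u,$$ where $u,v$ run over the basis, $i,j,n$ over $\mathbb Z$, and the normal ordering $:\ :$ moves annihilation operators to the right, with a sign for each exchange of two odd generators ($b$'s and $c$'s). Then $(Q+h)^2=0$, and the complex $(W^{\infty/2}\tilde\ell,Q+h)$ is acyclic: $H(W^{\infty/2}\tilde\ell,Q+h)=\ker(Q+h)/\mathrm{im}(Q+h)=K$, the one-dimensional space spanned by the class of the vacuum $\mathbf 1$. -/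

import Mathlib

open scoped TensorProduct

noncomputable section

namespace VOWA

/-! ### Weyl algebras -/

section Weyl

variable {K : Type*} [Field K] {V : Type*} [AddCommGroup V] [Module K V]

/-- The defining relations `v w - w v = ω(v, w)` of the Weyl algebra of a bilinear form `ω`. -/
inductive WeylRel (ω : V →ₗ[K] V →ₗ[K] K) : TensorAlgebra K V → TensorAlgebra K V → Prop
  | comm (v w : V) : WeylRel ω (TensorAlgebra.ι K v * TensorAlgebra.ι K w)
      (TensorAlgebra.ι K w * TensorAlgebra.ι K v + algebraMap K _ (ω v w))

/-- The Weyl algebra on a vector space `V` with a bilinear form `ω`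
(to be used for alternating `ω`). -/
abbrev WeylAlgebra (ω : V →ₗ[K] V →ₗ[K] K) : Type _ := RingQuot (WeylRel ω)

/-- The generators of the Weyl algebra. -/
def WeylAlgebra.ι (ω : V →ₗ[K] V →ₗ[K] K) : V →ₗ[K] WeylAlgebra ω :=
  (RingQuot.mkAlgHom K (WeylRel ω)).toLinearMap ∘ₗ TensorAlgebra.ι K

lemma WeylAlgebra.ι_mul_ι (ω : V →ₗ[K] V →ₗ[K] K) (v w : V) :
    WeylAlgebra.ι ω v * WeylAlgebra.ι ω w =
      WeylAlgebra.ι ω w * WeylAlgebra.ι ω v + algebraMap K _ (ω v w) := by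
  have h := RingQuot.mkAlgHom_rel K (WeylRel.comm (ω := ω) v w)
  simpa [WeylAlgebra.ι] using h

lemma WeylAlgebra.induction (ω : V →ₗ[K] V →ₗ[K] K) {C : WeylAlgebra ω → Prop}
    (hK : ∀ r : K, C (algebraMap K _ r)) (hι : ∀ v, C (WeylAlgebra.ι ω v))
    (hmul : ∀ a b, C a → C b → C (a * b)) (hadd : ∀ a b, C a → C b → C (a + b))
    (a : WeylAlgebra ω) : C a := by
  obtain ⟨x, rfl⟩ := RingQuot.mkAlgHom_surjective K (WeylRel ω) a
  induction x using TensorAlgebra.induction with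
  | algebraMap r => simpa using hK r
  | ι v => exact hι v
  | mul a b ha hb => rw [map_mul]; exact hmul _ _ ha hb
  | add a b ha hb => rw [map_add]; exact hadd _ _ ha hb

end Weyl

/-! ### The loop algebra, its restricted dual, and the two forms on their sum -/

section Loop

variable (K : Type*) [Field K] (ℓ : Type*) [LieRing ℓ] [LieAlgebra K ℓ]

/-- The loop algebra `ℓ ⊗ K[t, t⁻¹]`. -/
abbrev Loop : Type _ := LieAlgebra.loopAlgebra K ℤ ℓ

/-- The restricted dual `⨁ₙ Hom(ℓ ⊗ K t⁻ⁿ, K)` of the loop algebra; the summand of index `n`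
consists of the functionals on `ℓ ⊗ K t⁻ⁿ`, identified with functionals on `ℓ`. -/
def RestrictedDual : Type _ := ℤ →₀ Module.Dual K ℓ

instance : AddCommGroup (RestrictedDual K ℓ) :=
  inferInstanceAs (AddCommGroup (ℤ →₀ Module.Dual K ℓ))

instance : Module K (RestrictedDual K ℓ) :=
  inferInstanceAs (Module K (ℤ →₀ Module.Dual K ℓ))

/-- The restricted dual as the space of finitely supported families of functionals. -/
def RestrictedDual.toFinsupp : RestrictedDual K ℓ ≃ₗ[K] (ℤ →₀ Module.Dual K ℓ) :=
  LinearEquiv.refl K (ℤ →₀ Module.Dual K ℓ)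

variable {ℓ} in
/-- The element `uₙ = u ⊗ tⁿ` of the loop algebra. -/
def loopMode (n : ℤ) (u : ℓ) : Loop K ℓ := AddMonoidAlgebra.single n (1 : K) ⊗ₜ[K] u

variable {ℓ} in
lemma lie_loopMode (n m : ℤ) (u v : ℓ) :
    ⁅loopMode K n u, loopMode K m v⁆ = loopMode K (n + m) ⁅u, v⁆ := by
  rw [loopMode, loopMode, LieAlgebra.ExtendScalars.bracket_tmul,
    AddMonoidAlgebra.single_mul_single, mul_one, loopMode]

variable {K ℓ} in
/-- The functional `f` on `ℓ`, placed in degree `n` of the restricted dual. -/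
def dualMode (n : ℤ) (f : Module.Dual K ℓ) : RestrictedDual K ℓ :=
  (RestrictedDual.toFinsupp K ℓ).symm (Finsupp.single n f)

/-- The canonical pairing of the restricted dual with the loop algebra. -/
def pairing : RestrictedDual K ℓ →ₗ[K] Loop K ℓ →ₗ[K] K :=
  (Finsupp.lsum K fun n : ℤ =>
    LinearMap.lcomp K K
      (Finsupp.lapply (-n) ∘ₗ (LieAlgebra.LoopAlgebra.toFinsupp K ℤ ℓ).toLinearMap)) ∘ₗ
    (RestrictedDual.toFinsupp K ℓ).toLinearMap

lemma pairing_modes (n m : ℤ) (f : Module.Dual K ℓ) (u : ℓ) :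
    pairing K ℓ (dualMode n f) (loopMode K m u) = if m + n = 0 then f u else 0 := by
  simp only [pairing, dualMode, loopMode, LinearMap.comp_apply, LinearEquiv.coe_coe,
    LinearEquiv.apply_symm_apply, Finsupp.lsum_single, LinearMap.lcomp_apply,
    LieAlgebra.LoopAlgebra.toFinsupp_single_tmul,
    Finsupp.lapply_apply, Finsupp.single_apply, ← eq_neg_iff_add_eq_zero]
  split_ifs <;> simp

/-- The sum of the loop algebra and its restricted dual. -/
abbrev Double : Type _ := Loop K ℓ × RestrictedDual K ℓ

/-- The bilinear form `((x, f), (y, g)) ↦ ⟨f, y⟩`. -/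
def halfForm : Double K ℓ →ₗ[K] Double K ℓ →ₗ[K] K :=
  (pairing K ℓ).compl₁₂ (LinearMap.snd K _ _) (LinearMap.fst K _ _)

@[simp] lemma halfForm_apply (v w : Double K ℓ) :
    halfForm K ℓ v w = pairing K ℓ v.2 w.1 := rfl

/-- The symplectic form `((x, f), (y, g)) ↦ ⟨f, y⟩ - ⟨g, x⟩`. -/
def symplecticForm : Double K ℓ →ₗ[K] Double K ℓ →ₗ[K] K := halfForm K ℓ - (halfForm K ℓ).flip

/-- The quadratic form `(x, f) ↦ ⟨f, x⟩`. -/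
def quadForm : QuadraticForm K (Double K ℓ) := LinearMap.BilinMap.toQuadraticMap (halfForm K ℓ)

/-- The Clifford algebra generated by the `bₙᵘ` and `cₙᵘ'`. -/
abbrev Cliff : Type _ := CliffordAlgebra (quadForm K ℓ)

/-- The Weyl algebra generated by the `βₙᵘ` and `γₙᵘ'`. -/
abbrev Weyl : Type _ := WeylAlgebra (symplecticForm K ℓ)

/-- The vectors giving annihilation operators: `uₙ` for `n ≥ 0` and `u'ₙ` for `n ≥ 1`. -/
def annihilationVectors : Set (Double K ℓ) :=
  {v | ∃ n : ℤ, 0 ≤ n ∧ ∃ u : ℓ, v = (loopMode K n u, 0)} ∪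
    {v | ∃ n : ℤ, 1 ≤ n ∧ ∃ f : Module.Dual K ℓ, v = (0, dualMode n f)}

/-- The left ideal of the Weyl algebra generated by the annihilation operators. -/
def symIdeal : Submodule (Weyl K ℓ) (Weyl K ℓ) :=
  Submodule.span _ (WeylAlgebra.ι (symplecticForm K ℓ) '' annihilationVectors K ℓ)

/-- The left ideal of the Clifford algebra generated by the annihilation operators. -/
def extIdeal : Submodule (Cliff K ℓ) (Cliff K ℓ) :=
  Submodule.span _ (CliffordAlgebra.ι (quadForm K ℓ) '' annihilationVectors K ℓ)

/-- The semi-infinite symmetric module: the Weyl module induced from the trivial one-dimensional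
representation of the subalgebra generated by the annihilation operators. -/
abbrev SemiInfSym : Type _ := Weyl K ℓ ⧸ symIdeal K ℓ

/-- The semi-infinite exterior module: the Clifford module induced from the trivial one-dimensional
representation of the subalgebra generated by the annihilation operators. -/
abbrev SemiInfExt : Type _ := Cliff K ℓ ⧸ extIdeal K ℓ

/-- The semi-infinite Weil complex of the loop algebra, as a vector space. -/
abbrev SemiInfWeil : Type _ := SemiInfSym K ℓ ⊗[K] SemiInfExt K ℓ

/-- The vacuum vector. -/
def vacuum : SemiInfWeil K ℓ :=
  (symIdeal K ℓ).mkQ 1 ⊗ₜ[K] (extIdeal K ℓ).mkQ 1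

/-- The action on the Weil complex of the element `v` of the Weyl algebra. -/
def weylOp (v : Double K ℓ) : Module.End K (SemiInfWeil K ℓ) :=
  LinearMap.rTensor (SemiInfExt K ℓ)
    (Algebra.lsmul K K (SemiInfSym K ℓ) (WeylAlgebra.ι (symplecticForm K ℓ) v))

/-- The action on the Weil complex of the element `v` of the Clifford algebra. (The Weyl
generators, hence all of the symmetric module, are even, so there is no sign.) -/
def cliffOp (v : Double K ℓ) : Module.End K (SemiInfWeil K ℓ) :=
  LinearMap.lTensor (SemiInfSym K ℓ)
    (Algebra.lsmul K K (SemiInfExt K ℓ) (CliffordAlgebra.ι (quadForm K ℓ) v))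

/-! ### Modes and normal ordering -/

/-- The generators `bₙᵘ`, `cₙᵘ'`, `βₙᵘ`, `γₙᵘ'`. -/
inductive Gen : Type _
  | b (n : ℤ) (u : ℓ)
  | c (n : ℤ) (f : Module.Dual K ℓ)
  | β (n : ℤ) (u : ℓ)
  | γ (n : ℤ) (f : Module.Dual K ℓ)

variable {K ℓ}

/-- The operator of a generator. -/
def Gen.op : Gen K ℓ → Module.End K (SemiInfWeil K ℓ)
  | .b n u => cliffOp K ℓ (loopMode K n u, 0)
  | .c n f => cliffOp K ℓ (0, dualMode n f)
  | .β n u => weylOp K ℓ (loopMode K n u, 0)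
  | .γ n f => weylOp K ℓ (0, dualMode n f)

/-- Creation operators: `bₙ`, `βₙ` with `n ≤ -1`, and `cₙ`, `γₙ` with `n ≤ 0`. All other
generators are annihilation operators. -/
def Gen.IsCreation : Gen K ℓ → Prop
  | .b n _ => n ≤ -1
  | .c n _ => n ≤ 0
  | .β n _ => n ≤ -1
  | .γ n _ => n ≤ 0

/-- Parity: the `b`'s and `c`'s are odd, the `β`'s and `γ`'s are even. -/
def Gen.parity : Gen K ℓ → ℕ
  | .b _ _ => 1
  | .c _ _ => 1
  | .β _ _ => 0
  | .γ _ _ => 0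

open Classical in
/-- The normally ordered product of a list of generators: the annihilation operators are moved to
the right, with the sign rule. -/
def normalOrder : List (Gen K ℓ) → Module.End K (SemiInfWeil K ℓ)
  | [] => 1
  | g :: gs =>
      if g.IsCreation then g.op * normalOrder gs
      else (-1 : K) ^ (g.parity * (gs.map Gen.parity).sum) • (normalOrder gs * g.op)

/-- The index of a generator. -/
def Gen.mode : Gen K ℓ → ℤ
  | .b n _ => n
  | .c n _ => n
  | .β n _ => n
  | .γ n _ => n

/-! ### Locally finite sums of operators -/

section LocallyFinite

variable {M : Type*} [AddCommGroup M] [Module K M] {I : Type*}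

/-- A family of operators is locally finite if every vector is killed by all but finitely many. -/
def LocallyFinite (T : I → Module.End K M) : Prop := ∀ w, {i | T i w ≠ 0}.Finite

/-- The sum of a locally finite family of operators. -/
def locSum (T : I → Module.End K M) (hT : LocallyFinite T) : Module.End K M where
  toFun w := ∑ᶠ i, T i w
  map_add' x y := by
    simp only [map_add]
    exact finsum_add_distrib (hT x) (hT y)
  map_smul' r x := by
    simp only [map_smul, RingHom.id_apply]
    exact (smul_finsum' r (hT x)).symm

end LocallyFinite

/-! ### Local finiteness of the operators used below -/

lemma weylOp_comm (v w : Double K ℓ) (h : symplecticForm K ℓ v w = 0) (x : SemiInfWeil K ℓ) :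
    weylOp K ℓ v (weylOp K ℓ w x) = weylOp K ℓ w (weylOp K ℓ v x) := by
  have := WeylAlgebra.ι_mul_ι (symplecticForm K ℓ) v w
  rw [h, map_zero, add_zero] at this
  rw [← Module.End.mul_apply, ← Module.End.mul_apply]
  simp only [weylOp, ← LinearMap.rTensor_mul, ← map_mul, this]

lemma polar_quadForm (v w : Double K ℓ) :
    QuadraticMap.polar (quadForm K ℓ) v w = pairing K ℓ v.2 w.1 + pairing K ℓ w.2 v.1 := by
  simp [QuadraticMap.polar, quadForm]
  ring

lemma cliffOp_anticomm (v w : Double K ℓ)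
    (h : pairing K ℓ v.2 w.1 + pairing K ℓ w.2 v.1 = 0) (x : SemiInfWeil K ℓ) :
    cliffOp K ℓ v (cliffOp K ℓ w x) = - cliffOp K ℓ w (cliffOp K ℓ v x) := by
  have := CliffordAlgebra.ι_mul_ι_add_swap (Q := quadForm K ℓ) v w
  rw [polar_quadForm, h, map_zero] at this
  rw [← Module.End.mul_apply, ← Module.End.mul_apply, ← LinearMap.neg_apply]
  simp only [cliffOp, ← LinearMap.lTensor_mul, ← map_mul, eq_neg_of_add_eq_zero_left this,
    map_neg, LinearMap.lTensor_neg]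

lemma weylOp_cliffOp (v w : Double K ℓ) (x : SemiInfWeil K ℓ) :
    weylOp K ℓ v (cliffOp K ℓ w x) = cliffOp K ℓ w (weylOp K ℓ v x) := by
  rw [← Module.End.mul_apply, ← Module.End.mul_apply]
  simp only [weylOp, cliffOp, Module.End.mul_eq_comp, LinearMap.rTensor_comp_lTensor,
    LinearMap.lTensor_comp_rTensor]

/-- Annihilation operators supercommute. -/
lemma Gen.op_op_eq_zero {g a : Gen K ℓ} (hg : ¬ g.IsCreation) (ha : ¬ a.IsCreation)
    {x : SemiInfWeil K ℓ} (hx : g.op x = 0) : g.op (a.op x) = 0 := by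
  cases g <;> cases a <;> simp only [Gen.op, Gen.IsCreation] at hg ha hx ⊢
  case b.b => rw [cliffOp_anticomm _ _ (by simp), hx]; simp
  case b.c => rw [cliffOp_anticomm _ _ (by simp [pairing_modes]; omega), hx]; simp
  case c.b => rw [cliffOp_anticomm _ _ (by simp [pairing_modes]; omega), hx]; simp
  case c.c => rw [cliffOp_anticomm _ _ (by simp), hx]; simp
  case β.β => rw [weylOp_comm _ _ (by simp [symplecticForm]), hx]; simp
  case β.γ => rw [weylOp_comm _ _ (by simp [symplecticForm, pairing_modes]; omega), hx]; simp
  case γ.β => rw [weylOp_comm _ _ (by simp [symplecticForm, pairing_modes]; omega), hx]; simp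
  case γ.γ => rw [weylOp_comm _ _ (by simp [symplecticForm]), hx]; simp
  all_goals first
    | rw [weylOp_cliffOp, hx, map_zero]
    | rw [← weylOp_cliffOp, hx, map_zero]

lemma normalOrder_eq_zero {gs : List (Gen K ℓ)} {g : Gen K ℓ} (hg : g ∈ gs)
    (hc : ¬ g.IsCreation) {x : SemiInfWeil K ℓ} (hx : g.op x = 0) : normalOrder gs x = 0 := by
  induction gs generalizing x with
  | nil => simp at hg
  | cons a as ih =>
    rw [normalOrder]
    rcases List.mem_cons.1 hg with rfl | hg'
    · simp [hc, hx]
    · split_ifs with ha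
      · simp [ih hg' hx]
      · simp [ih hg' (Gen.op_op_eq_zero hc ha hx)]

/-- The vectors `uₙ` and `u'ₙ`, for `n` at least `N`. -/
def highVectors (K : Type*) [Field K] (ℓ : Type*) [LieRing ℓ] [LieAlgebra K ℓ] (N : ℤ) :
    Set (Double K ℓ) :=
  {v | ∃ n : ℤ, N ≤ n ∧ ∃ u : ℓ, v = (loopMode K n u, 0)} ∪
    {v | ∃ n : ℤ, N ≤ n ∧ ∃ f : Module.Dual K ℓ, v = (0, dualMode n f)}

lemma highVectors_anti {N N' : ℤ} (h : N ≤ N') : highVectors K ℓ N' ⊆ highVectors K ℓ N := by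
  rintro v (⟨n, hn, u, rfl⟩ | ⟨n, hn, u, rfl⟩)
  · exact Or.inl ⟨n, by omega, u, rfl⟩
  · exact Or.inr ⟨n, by omega, u, rfl⟩

lemma highVectors_one : highVectors K ℓ 1 ⊆ annihilationVectors K ℓ := by
  rintro v (⟨n, hn, u, rfl⟩ | ⟨n, hn, u, rfl⟩)
  · exact Or.inl ⟨n, by omega, u, rfl⟩
  · exact Or.inr ⟨n, by omega, u, rfl⟩

lemma exists_pairing_eq_zero (m : Double K ℓ) :
    ∃ N : ℤ, ∀ v ∈ highVectors K ℓ N, pairing K ℓ v.2 m.1 = 0 ∧ pairing K ℓ m.2 v.1 = 0 := by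
  obtain ⟨x, f⟩ := m
  have h1 : ∃ N : ℤ, ∀ n ≥ N, ∀ g : Module.Dual K ℓ, pairing K ℓ (dualMode n g) x = 0 := by
    induction x using TensorProduct.induction_on with
    | zero => exact ⟨0, by simp⟩
    | add x y hx hy =>
      obtain ⟨N, hN⟩ := hx
      obtain ⟨N', hN'⟩ := hy
      refine ⟨max N N', fun n hn g => ?_⟩
      rw [map_add, hN n (le_trans (le_max_left _ _) hn), hN' n (le_trans (le_max_right _ _) hn),
        add_zero]
    | tmul p u =>
      induction p using AddMonoidAlgebra.induction_linear with
      | zero => exact ⟨0, by simp⟩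
      | add x y hx hy =>
        obtain ⟨N, hN⟩ := hx
        obtain ⟨N', hN'⟩ := hy
        refine ⟨max N N', fun n hn g => ?_⟩
        rw [TensorProduct.add_tmul, map_add, hN n (le_trans (le_max_left _ _) hn),
          hN' n (le_trans (le_max_right _ _) hn), add_zero]
      | single k r =>
        refine ⟨-k + 1, fun n hn g => ?_⟩
        have : (AddMonoidAlgebra.single k r : AddMonoidAlgebra K ℤ) ⊗ₜ[K] u
            = loopMode K k (r • u) := by
          rw [loopMode, ← TensorProduct.smul_tmul, AddMonoidAlgebra.smul_single, smul_eq_mul, mul_one]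
        rw [this, pairing_modes, if_neg (by omega)]
  have h2 : ∃ N : ℤ, ∀ n ≥ N, ∀ u : ℓ, pairing K ℓ f (loopMode K n u) = 0 := by
    obtain ⟨f, rfl⟩ := (RestrictedDual.toFinsupp K ℓ).symm.surjective f
    induction f using Finsupp.induction_linear with
    | zero => exact ⟨0, by simp⟩
    | add x y hx hy =>
      obtain ⟨N, hN⟩ := hx
      obtain ⟨N', hN'⟩ := hy
      refine ⟨max N N', fun n hn g => ?_⟩
      rw [map_add, map_add, LinearMap.add_apply, hN n (le_trans (le_max_left _ _) hn),
        hN' n (le_trans (le_max_right _ _) hn), add_zero]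
    | single k g =>
      refine ⟨-k + 1, fun n hn u => ?_⟩
      exact (pairing_modes K ℓ k n g u).trans (if_neg (by omega))
  obtain ⟨N, hN⟩ := h1
  obtain ⟨N', hN'⟩ := h2
  refine ⟨max N N', ?_⟩
  rintro v (⟨n, hn, u, rfl⟩ | ⟨n, hn, g, rfl⟩)
  · exact ⟨by simp, hN' n (le_trans (le_max_right _ _) hn) u⟩
  · exact ⟨hN n (le_trans (le_max_left _ _) hn) g, by simp⟩

lemma exists_weyl_mem (a : Weyl K ℓ) : ∃ N : ℤ, ∀ v ∈ highVectors K ℓ N,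
    WeylAlgebra.ι (symplecticForm K ℓ) v * a ∈ symIdeal K ℓ := by
  let P : Weyl K ℓ → Prop := fun x => ∃ N : ℤ, ∀ v ∈ highVectors K ℓ N,
    WeylAlgebra.ι (symplecticForm K ℓ) v * x ∈ symIdeal K ℓ
  have hadd : ∀ x y, P x → P y → P (x + y) := by
    rintro x y ⟨N, hN⟩ ⟨N', hN'⟩
    refine ⟨max N N', fun v hv => ?_⟩
    rw [mul_add]
    exact add_mem (hN v (highVectors_anti (le_max_left _ _) hv))
      (hN' v (highVectors_anti (le_max_right _ _) hv))
  have key : ∀ a : Weyl K ℓ, ∀ x, P x → P (a * x) := by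
    intro a
    induction a using WeylAlgebra.induction with
    | hK r =>
      rintro x ⟨N, hN⟩
      refine ⟨N, fun v hv => ?_⟩
      rw [Algebra.left_comm]
      exact (symIdeal K ℓ).smul_mem _ (hN v hv)
    | hι m =>
      rintro x ⟨N, hN⟩
      obtain ⟨N', hN'⟩ := exists_pairing_eq_zero m
      refine ⟨max N N', fun v hv => ?_⟩
      have h := hN' v (highVectors_anti (le_max_right _ _) hv)
      rw [← mul_assoc, WeylAlgebra.ι_mul_ι]
      have h0 : symplecticForm K ℓ v m = 0 := by simp [symplecticForm, h.1, h.2]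
      rw [h0, map_zero, add_zero, mul_assoc]
      exact (symIdeal K ℓ).smul_mem _ (hN v (highVectors_anti (le_max_left _ _) hv))
    | hmul a b ha hb => intro x hx; rw [mul_assoc]; exact ha _ (hb _ hx)
    | hadd a b ha hb => intro x hx; rw [add_mul]; exact hadd _ _ (ha _ hx) (hb _ hx)
  have h1 : P 1 := ⟨1, fun v hv => by
    rw [mul_one]
    exact Submodule.subset_span ⟨v, highVectors_one hv, rfl⟩⟩
  simpa [P] using key a 1 h1

lemma exists_cliff_mem (a : Cliff K ℓ) : ∃ N : ℤ, ∀ v ∈ highVectors K ℓ N,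
    CliffordAlgebra.ι (quadForm K ℓ) v * a ∈ extIdeal K ℓ := by
  let P : Cliff K ℓ → Prop := fun x => ∃ N : ℤ, ∀ v ∈ highVectors K ℓ N,
    CliffordAlgebra.ι (quadForm K ℓ) v * x ∈ extIdeal K ℓ
  have hadd : ∀ x y, P x → P y → P (x + y) := by
    rintro x y ⟨N, hN⟩ ⟨N', hN'⟩
    refine ⟨max N N', fun v hv => ?_⟩
    rw [mul_add]
    exact add_mem (hN v (highVectors_anti (le_max_left _ _) hv))
      (hN' v (highVectors_anti (le_max_right _ _) hv))
  have key : ∀ a : Cliff K ℓ, ∀ x, P x → P (a * x) := by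
    intro a
    induction a using CliffordAlgebra.induction with
    | algebraMap r =>
      rintro x ⟨N, hN⟩
      refine ⟨N, fun v hv => ?_⟩
      rw [Algebra.left_comm]
      exact (extIdeal K ℓ).smul_mem _ (hN v hv)
    | ι m =>
      rintro x ⟨N, hN⟩
      obtain ⟨N', hN'⟩ := exists_pairing_eq_zero m
      refine ⟨max N N', fun v hv => ?_⟩
      have h := hN' v (highVectors_anti (le_max_right _ _) hv)
      rw [← mul_assoc, CliffordAlgebra.ι_mul_ι_comm, polar_quadForm, h.1, h.2, add_zero,
        map_zero, zero_sub, neg_mul, mul_assoc]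
      exact neg_mem ((extIdeal K ℓ).smul_mem _
        (hN v (highVectors_anti (le_max_left _ _) hv)))
    | mul a b ha hb => intro x hx; rw [mul_assoc]; exact ha _ (hb _ hx)
    | add a b ha hb => intro x hx; rw [add_mul]; exact hadd _ _ (ha _ hx) (hb _ hx)
  have h1 : P 1 := ⟨1, fun v hv => by
    rw [mul_one]
    exact Submodule.subset_span ⟨v, highVectors_one hv, rfl⟩⟩
  simpa [P] using key a 1 h1

/-- Every vector is killed by all generators of sufficiently large index. -/
lemma exists_bound (w : SemiInfWeil K ℓ) :
    ∃ N : ℤ, 1 ≤ N ∧ ∀ g : Gen K ℓ, N ≤ g.mode → g.op w = 0 := by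
  have main : ∃ N : ℤ, ∀ v ∈ highVectors K ℓ N, weylOp K ℓ v w = 0 ∧ cliffOp K ℓ v w = 0 := by
    induction w using TensorProduct.induction_on with
    | zero => exact ⟨0, by simp⟩
    | add x y hx hy =>
      obtain ⟨N, hN⟩ := hx
      obtain ⟨N', hN'⟩ := hy
      refine ⟨max N N', fun v hv => ?_⟩
      have h := hN v (highVectors_anti (le_max_left _ _) hv)
      have h' := hN' v (highVectors_anti (le_max_right _ _) hv)
      simp [h.1, h.2, h'.1, h'.2]
    | tmul s e =>
      obtain ⟨a, rfl⟩ := (symIdeal K ℓ).mkQ_surjective s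
      obtain ⟨d, rfl⟩ := (extIdeal K ℓ).mkQ_surjective e
      obtain ⟨N, hN⟩ := exists_weyl_mem a
      obtain ⟨N', hN'⟩ := exists_cliff_mem d
      refine ⟨max N N', fun v hv => ?_⟩
      have h := hN v (highVectors_anti (le_max_left _ _) hv)
      have h' := hN' v (highVectors_anti (le_max_right _ _) hv)
      constructor
      · rw [weylOp, LinearMap.rTensor_tmul, Algebra.lsmul_coe]
        beta_reduce
        rw [← map_smul, smul_eq_mul, Submodule.mkQ_apply,
          (Submodule.Quotient.mk_eq_zero _).2 h, TensorProduct.zero_tmul]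
      · rw [cliffOp, LinearMap.lTensor_tmul, Algebra.lsmul_coe]
        beta_reduce
        rw [← map_smul, smul_eq_mul, (extIdeal K ℓ).mkQ_apply,
          (Submodule.Quotient.mk_eq_zero _).2 h', TensorProduct.tmul_zero]
  obtain ⟨N, hN⟩ := main
  refine ⟨max N 1, le_max_right _ _, fun g hg => ?_⟩
  cases g with
  | b n u => exact (hN _ (Or.inl ⟨n, le_trans (le_max_left _ _) hg, u, rfl⟩)).2
  | c n u => exact (hN _ (Or.inr ⟨n, le_trans (le_max_left _ _) hg, u, rfl⟩)).2
  | β n u => exact (hN _ (Or.inl ⟨n, le_trans (le_max_left _ _) hg, u, rfl⟩)).1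
  | γ n u => exact (hN _ (Or.inr ⟨n, le_trans (le_max_left _ _) hg, u, rfl⟩)).1

lemma exists_normalOrder_bound (w : SemiInfWeil K ℓ) : ∃ N : ℤ, ∀ gs : List (Gen K ℓ),
    normalOrder gs w ≠ 0 → ∀ g ∈ gs, g.mode < N := by
  obtain ⟨N, h1, hN⟩ := exists_bound w
  refine ⟨N, fun gs h g hg => ?_⟩
  by_contra hlt
  rw [not_lt] at hlt
  refine h (normalOrder_eq_zero hg ?_ (hN g hlt))
  cases g <;> simp only [Gen.IsCreation, Gen.mode] at hlt ⊢ <;> omega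

/-! ### The operators -/

section Operators

variable {ι : Type*} (e : Module.Basis ι K ℓ)

/-- The terms `:β_{i+j}^{[u,v]} γ_{-i}^{v'} c_{-j}^{u'}:`. -/
def symTerm (p : (ι × ι) × (ℤ × ℤ)) : Module.End K (SemiInfWeil K ℓ) :=
  normalOrder [.β (p.2.1 + p.2.2) ⁅e p.1.1, e p.1.2⁆, .γ (-p.2.1) (e.coord p.1.2),
    .c (-p.2.2) (e.coord p.1.1)]

/-- The terms `:b_{i+j}^{[u,v]} c_{-i}^{v'} c_{-j}^{u'}:`. -/
def extTerm (p : (ι × ι) × (ℤ × ℤ)) : Module.End K (SemiInfWeil K ℓ) :=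
  normalOrder [.b (p.2.1 + p.2.2) ⁅e p.1.1, e p.1.2⁆, .c (-p.2.1) (e.coord p.1.2),
    .c (-p.2.2) (e.coord p.1.1)]

/-- The terms `γ_{-n}^{u'} b_n^u`. (The two factors commute.) -/
def koszulTerm (p : ι × ℤ) : Module.End K (SemiInfWeil K ℓ) :=
  normalOrder [.γ (-p.2) (e.coord p.1), .b p.2 (e p.1)]

variable [Finite ι]

lemma symTerm_locallyFinite : LocallyFinite (symTerm e) := by
  intro w
  obtain ⟨N, hN⟩ := exists_normalOrder_bound w
  refine ((Set.finite_univ (α := ι × ι)).prod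
    ((Set.finite_Icc (-N) (2 * N)).prod (Set.finite_Icc (-N) (2 * N)))).subset ?_
  rintro ⟨⟨u, v⟩, i, j⟩ h
  have h' := hN _ h
  simp only [List.mem_cons, List.not_mem_nil, or_false, forall_eq_or_imp, forall_eq,
    Gen.mode] at h'
  simp only [Set.mem_prod, Set.mem_univ, true_and, Set.mem_Icc]
  omega

lemma extTerm_locallyFinite : LocallyFinite (extTerm e) := by
  intro w
  obtain ⟨N, hN⟩ := exists_normalOrder_bound w
  refine ((Set.finite_univ (α := ι × ι)).prod
    ((Set.finite_Icc (-N) (2 * N)).prod (Set.finite_Icc (-N) (2 * N)))).subset ?_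
  rintro ⟨⟨u, v⟩, i, j⟩ h
  have h' := hN _ h
  simp only [List.mem_cons, List.not_mem_nil, or_false, forall_eq_or_imp, forall_eq,
    Gen.mode] at h'
  simp only [Set.mem_prod, Set.mem_univ, true_and, Set.mem_Icc]
  omega

lemma koszulTerm_locallyFinite : LocallyFinite (koszulTerm e) := by
  intro w
  obtain ⟨N, hN⟩ := exists_normalOrder_bound w
  refine ((Set.finite_univ (α := ι)).prod (Set.finite_Icc (-N) N)).subset ?_
  rintro ⟨u, n⟩ h
  have h' := hN _ h
  simp only [List.mem_cons, List.not_mem_nil, or_false, forall_eq_or_imp, forall_eq,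
    Gen.mode] at h'
  simp only [Set.mem_prod, Set.mem_univ, true_and, Set.mem_Icc]
  omega

/-- The semi-infinite cohomology differential
`Q = ∑ :β_{i+j}^{[u,v]} γ_{-i}^{v'} c_{-j}^{u'}: + ½ ∑ :b_{i+j}^{[u,v]} c_{-i}^{v'} c_{-j}^{u'}:`,
both sums over all basis elements `u`, `v` and all integers `i`, `j`. -/
def Q : Module.End K (SemiInfWeil K ℓ) :=
  locSum (symTerm e) (symTerm_locallyFinite e) +
    (1 / 2 : K) • locSum (extTerm e) (extTerm_locallyFinite e)

/-- The semi-infinite Koszul differential `h = ∑ γ_{-n}^{u'} b_n^u`. -/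
def koszul : Module.End K (SemiInfWeil K ℓ) := locSum (koszulTerm e) (koszulTerm_locallyFinite e)

end Operators

end Loop

/-- The cohomology `ker D / im D` of an operator `D` (with `D² = 0`). -/
abbrev Cohomology {K : Type*} [Field K] {M : Type*} [AddCommGroup M] [Module K M]
    (D : Module.End K M) : Type _ :=
  LinearMap.ker D ⧸ (LinearMap.range D).submoduleOf (LinearMap.ker D)

end VOWA

end

namespace VOWA

/-! ### Finitely supported sums -/

section FiniteSums

variable {K M M' : Type*} [Field K] [AddCommGroup M] [Module K M] [AddCommGroup M'] [Module K M']
  {I J : Type*}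

/-! The operator $Q+h$ is conjugate to $h$. Let $T=\frac12\sum\beta^{[u,v]}c^{v'}c^{u'}$, the sum
over a homogeneous basis of the loop algebra with its dual basis (`ModeRep.twist`). All factors of
$T$ supercommute, so no normal ordering is needed. The bracket of $h$ with $\beta$ is $b$, its
bracket with $c$ is $\gamma$, and it supercommutes with $b$ and $\gamma$. Hence $[h,T]$ is the cubic
expression of $Q$. Normal ordering of the $\beta\gamma c$ terms and of the $bcc$ terms produces
scalar contractions that cancel each other, so $[h,T]=Q$ exactly (`ModeRep.koszulOp_twistTerm`,
`ModeRep.total_eq`).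

The brackets $[T,b]$ and $[T,\gamma]$ involve only $\beta$ and $c$, so they commute with $T$. Since
$h=\sum\gamma b$, the double bracket of $h$ with $T$ is $2\sum[T,\gamma^{u'}][T,b^u]$. This is a sum
of terms $\beta^{[[x,y],z]}$ times three $c$'s, and it vanishes by the Jacobi identity
(`ModeRep.koszulOp_twist_twist`). The operator $T$ is locally nilpotent, because it kills the cyclic
vacuum and its second bracket with each generator is zero. Therefore $e^T$ is defined and bijective,
it fixes the vacuum, and $h\,e^T=e^T(h+[h,T])=e^T(Q+h)$ (`ModeRep.koszulOp_localExp`). In particular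
$(Q+h)^2=0$ follows from $h^2=0$.

It remains to compute the homology of $h$. With $k=\sum\pm\beta c$ and suitable signs, $hk+kh$
multiplies a product of $r$ creation operators on the vacuum by $r$. In characteristic zero only
$r=0$ contributes, which leaves the vacuum line (`homology_of_homotopy`, `ModeRep.homology_total`).
That the vacuum is non-zero is seen in the polynomial and exterior representations
(`vacuum_ne_zero`). -/

/-- The family `f` has finite support and sum `s`. -/
def HasFinsum (f : I → M) (s : M) : Prop := f.support.Finite ∧ ∑ᶠ i, f i = s

lemma HasFinsum.unique {f : I → M} {s t : M} (hs : HasFinsum f s) (ht : HasFinsum f t) : s = t :=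
  hs.2.symm.trans ht.2

lemma HasFinsum.congr {f g : I → M} {s : M} (hf : HasFinsum f s) (h : ∀ i, g i = f i) :
    HasFinsum g s := (funext h : g = f) ▸ hf

lemma HasFinsum.add {f g : I → M} {s t : M} (hf : HasFinsum f s) (hg : HasFinsum g t) :
    HasFinsum (fun i => f i + g i) (s + t) := by
  refine ⟨(hf.1.union hg.1).subset (Function.support_add f g), ?_⟩
  rw [finsum_add_distrib hf.1 hg.1, hf.2, hg.2]

lemma HasFinsum.map {f : I → M} {s : M} (hf : HasFinsum f s) (L : M →ₗ[K] M') :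
    HasFinsum (fun i => L (f i)) (L s) := by
  refine ⟨hf.1.subset fun i hi h => hi (by simp [h]), ?_⟩
  rw [← hf.2]
  exact (map_finsum L hf.1).symm

lemma HasFinsum.smul {f : I → M} {s : M} (hf : HasFinsum f s) (r : K) :
    HasFinsum (fun i => r • f i) (r • s) :=
  hf.map (r • (LinearMap.id : M →ₗ[K] M))

lemma HasFinsum.neg {f : I → M} {s : M} (hf : HasFinsum f s) :
    HasFinsum (fun i => -f i) (-s) :=
  ⟨by simpa [Function.support_neg] using hf.1, by rw [finsum_neg_distrib, hf.2]⟩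

lemma HasFinsum.sub {f g : I → M} {s t : M} (hf : HasFinsum f s) (hg : HasFinsum g t) :
    HasFinsum (fun i => f i - g i) (s - t) := by
  simpa only [sub_eq_add_neg] using hf.add hg.neg

lemma hasFinsum_zero : HasFinsum (fun _ : I => (0 : M)) 0 := by
  simp [HasFinsum]

lemma HasFinsum.equiv {f : I → M} {s : M} (hf : HasFinsum f s) (σ : J ≃ I) :
    HasFinsum (fun j => f (σ j)) s :=
  ⟨hf.1.preimage σ.injective.injOn, (finsum_comp_equiv σ).trans hf.2⟩

/-- Fubini for finite supports: the support of the partial sums lies in the projection of the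
support of `f`. Finiteness of the joint support is essential, and it is what has to be checked at
each interchange of sums below. -/
lemma HasFinsum.prod {f : I × J → M} {g : I → M} {s : M} (hf : HasFinsum f s)
    (hg : ∀ i, HasFinsum (fun j => f (i, j)) (g i)) : HasFinsum g s := by
  refine ⟨(hf.1.image Prod.fst).subset fun i hi => ?_, ?_⟩
  · by_contra h
    refine hi ?_
    rw [← (hg i).2, ← finsum_zero (α := J)]
    congr 1
    funext j
    by_contra hj
    exact h ⟨(i, j), hj, rfl⟩
  · rw [← hf.2, finsum_curry f hf.1]
    exact finsum_congr fun i => (hg i).2.symm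

lemma hasFinsum_of_finite {f : I → M} (hf : f.support.Finite) : HasFinsum f (∑ᶠ i, f i) :=
  ⟨hf, rfl⟩

lemma hasFinsum_locSum {T : I → Module.End K M} (hT : LocallyFinite T) (w : M) :
    HasFinsum (fun i => T i w) (locSum T hT w) :=
  ⟨hT w, rfl⟩

/-- The bracket of a locally finite sum with an operator, computed termwise. -/
lemma hasFinsum_bracket {T : I → Module.End K M} (hT : LocallyFinite T) (A : Module.End K M)
    (r : K) (R : I → M) (w : M) (h : ∀ i, T i (A w) = r • A (T i w) + R i) :
    HasFinsum R (locSum T hT (A w) - r • A (locSum T hT w)) :=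
  ((hasFinsum_locSum hT (A w)).sub (((hasFinsum_locSum hT w).map A).smul r)).congr fun i => by
    rw [h i]; abel

lemma locSum_apply_comm {T : I → Module.End K M} (hT : LocallyFinite T) (A : Module.End K M)
    (h : ∀ i w, T i (A w) = A (T i w)) (w : M) : locSum T hT (A w) = A (locSum T hT w) := by
  have := hasFinsum_bracket hT A 1 (fun _ => 0) w fun i => by simp [h]
  simpa [sub_eq_zero] using this.unique hasFinsum_zero

lemma locSum_apply_anticomm {T : I → Module.End K M} (hT : LocallyFinite T) (A : Module.End K M)
    (h : ∀ i w, T i (A w) = - A (T i w)) (w : M) : locSum T hT (A w) = - A (locSum T hT w) := by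
  have := hasFinsum_bracket hT A (-1) (fun _ => 0) w fun i => by simp [h]
  simpa [add_eq_zero_iff_eq_neg] using this.unique hasFinsum_zero

end FiniteSums

/-! ### Reduction to homogeneous elements -/

section Modes

variable {K : Type*} [Field K] {ℓ : Type*} [LieRing ℓ] [LieAlgebra K ℓ]

lemma loopMode_smul (n : ℤ) (r : K) (u : ℓ) : loopMode K n (r • u) = r • loopMode K n u :=
  TensorProduct.tmul_smul _ _ _

lemma dualMode_smul (n : ℤ) (r : K) (f : Module.Dual K ℓ) :
    dualMode n (r • f) = r • dualMode n f := by
  rw [dualMode, dualMode, ← map_smul, Finsupp.smul_single]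

lemma loop_induction {P : Loop K ℓ → Prop} (h0 : P 0) (hadd : ∀ x y, P x → P y → P (x + y))
    (hmode : ∀ n u, P (loopMode K n u)) (x : Loop K ℓ) : P x := by
  obtain ⟨x, rfl⟩ := (LieAlgebra.LoopAlgebra.toFinsupp K ℤ ℓ).symm.surjective x
  induction x using Finsupp.induction_linear with
  | zero => simpa using h0
  | add x y hx hy => rw [map_add]; exact hadd _ _ hx hy
  | single n u =>
    rw [LieAlgebra.LoopAlgebra.toFinsupp_symm_single]
    exact hmode n u

lemma restrictedDual_induction {P : RestrictedDual K ℓ → Prop} (h0 : P 0)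
    (hadd : ∀ x y, P x → P y → P (x + y)) (hmode : ∀ n f, P (dualMode n f))
    (x : RestrictedDual K ℓ) : P x := by
  obtain ⟨x, rfl⟩ := (RestrictedDual.toFinsupp K ℓ).symm.surjective x
  induction x using Finsupp.induction_linear with
  | zero => simpa using h0
  | add x y hx hy => rw [map_add]; exact hadd _ _ hx hy
  | single n f => exact hmode n f

end Modes

/-! ### Abstract modules over the mode operators -/

/-- Operators `b`, `c`, `β`, `γ` on `M` that satisfy the relations of the Clifford and Weyl algebras
of a loop algebra and its restricted dual, with a cyclic vacuum vector that is killed by the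
annihilation operators. -/
structure ModeRep (K : Type*) [Field K] (ℓ : Type*) [LieRing ℓ] [LieAlgebra K ℓ]
    (M : Type*) [AddCommGroup M] [Module K M] where
  /-- The operators `b`. -/
  b : Loop K ℓ →ₗ[K] Module.End K M
  /-- The operators `c`. -/
  c : RestrictedDual K ℓ →ₗ[K] Module.End K M
  /-- The operators `β`. -/
  β : Loop K ℓ →ₗ[K] Module.End K M
  /-- The operators `γ`. -/
  γ : RestrictedDual K ℓ →ₗ[K] Module.End K M
  γ_β : ∀ f x w, γ f (β x w) = β x (γ f w) + pairing K ℓ f x • w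
  β_β : ∀ x y w, β x (β y w) = β y (β x w)
  γ_γ : ∀ f g w, γ f (γ g w) = γ g (γ f w)
  c_b : ∀ f x w, c f (b x w) = -b x (c f w) + pairing K ℓ f x • w
  b_b : ∀ x y w, b x (b y w) = -b y (b x w)
  c_c : ∀ f g w, c f (c g w) = -c g (c f w)
  b_β : ∀ x y w, b x (β y w) = β y (b x w)
  c_β : ∀ f x w, c f (β x w) = β x (c f w)
  b_γ : ∀ x f w, b x (γ f w) = γ f (b x w)
  c_γ : ∀ f g w, c f (γ g w) = γ g (c f w)
  exists_bound : ∀ w, ∃ N : ℤ, ∀ n, N ≤ n →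
    (∀ u : ℓ, b (loopMode K n u) w = 0 ∧ β (loopMode K n u) w = 0) ∧
    ∀ f : Module.Dual K ℓ, c (dualMode n f) w = 0 ∧ γ (dualMode n f) w = 0
  /-- The vacuum vector. -/
  vac : M
  b_vac : ∀ n, 0 ≤ n → ∀ u : ℓ, b (loopMode K n u) vac = 0
  β_vac : ∀ n, 0 ≤ n → ∀ u : ℓ, β (loopMode K n u) vac = 0
  c_vac : ∀ n, 1 ≤ n → ∀ f : Module.Dual K ℓ, c (dualMode n f) vac = 0
  γ_vac : ∀ n, 1 ≤ n → ∀ f : Module.Dual K ℓ, γ (dualMode n f) vac = 0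
  eq_top_of_stable : ∀ P : Submodule K M, vac ∈ P →
    (∀ n (u : ℓ), ∀ w ∈ P, b (loopMode K n u) w ∈ P) →
    (∀ n (f : Module.Dual K ℓ), ∀ w ∈ P, c (dualMode n f) w ∈ P) →
    (∀ n (u : ℓ), ∀ w ∈ P, β (loopMode K n u) w ∈ P) →
    (∀ n (f : Module.Dual K ℓ), ∀ w ∈ P, γ (dualMode n f) w ∈ P) → P = ⊤

lemma ModeRep.b_c {K : Type*} [Field K] {ℓ : Type*} [LieRing ℓ] [LieAlgebra K ℓ]
    {M : Type*} [AddCommGroup M] [Module K M] (F : ModeRep K ℓ M) (x : Loop K ℓ)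
    (f : RestrictedDual K ℓ) (w : M) :
    F.b x (F.c f w) = -F.c f (F.b x w) + pairing K ℓ f x • w := by
  rw [F.c_b]; abel

lemma hasFinsum_of_fiber {M I J : Type*} [AddCommGroup M] [Finite I] {F : I × J → M} {s : M}
    (j : J) (h0 : ∀ i j', j' ≠ j → F (i, j') = 0) (hs : HasFinsum (fun i => F (i, j)) s) :
    HasFinsum F s := by
  have hfin : F.support.Finite := by
    refine ((Set.finite_univ (α := I)).prod (Set.finite_singleton j)).subset ?_
    rintro ⟨i, j'⟩ h
    by_contra hj
    exact h (h0 i j' fun h' => hj ⟨trivial, h'⟩)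
  refine ⟨hfin, ?_⟩
  rw [finsum_curry F hfin, ← hs.2]
  exact finsum_congr fun i => finsum_eq_single _ _ fun j' hj => h0 i j' hj

/-! ### Expansion in the dual bases of modes -/

section Expansions

variable {K : Type*} [Field K] {ℓ : Type*} [LieRing ℓ] [LieAlgebra K ℓ] {ι : Type*}
  (e : Module.Basis ι K ℓ)

/-- The basis of the loop algebra formed by the modes of the basis elements. -/
noncomputable def modeVec (a : ι × ℤ) : Loop K ℓ := loopMode K a.2 (e a.1)

/-- The basis of the restricted dual that is dual to `modeVec`. -/
noncomputable def modeCovec (a : ι × ℤ) : RestrictedDual K ℓ := dualMode (-a.2) (e.coord a.1)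

lemma lie_modeVec (a b : ι × ℤ) :
    ⁅modeVec e a, modeVec e b⁆ = loopMode K (a.2 + b.2) ⁅e a.1, e b.1⁆ :=
  lie_loopMode _ _ _ _ _

lemma finite_pairing_modeVec [Finite ι] (x : Loop K ℓ) :
    {a | pairing K ℓ (modeCovec e a) x ≠ 0}.Finite := by
  induction x using loop_induction with
  | h0 => simp
  | hadd x y hx hy =>
    refine (hx.union hy).subset fun a ha => ?_
    by_contra h
    simp only [Set.mem_union, Set.mem_ofPred_eq, not_or, not_not] at h
    exact ha (by rw [map_add, h.1, h.2, add_zero])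
  | hmode n u =>
    refine ((Set.finite_univ (α := ι)).prod (Set.finite_singleton n)).subset ?_
    rintro ⟨i, m⟩ h
    refine ⟨trivial, ?_⟩
    by_contra hm
    exact h ((pairing_modes K ℓ _ _ _ _).trans (if_neg fun h' => hm (by
      simp only [Set.mem_singleton_iff] at *; omega)))

variable [Finite ι]

/-- Completeness of the dual bases. It evaluates the sums of contractions that arise in brackets: a
sum of $\langle u',x\rangle L(u)$ collapses to $L(x)$. -/
lemma hasFinsum_modeVec (x : Loop K ℓ) :
    HasFinsum (fun a => pairing K ℓ (modeCovec e a) x • modeVec e a) x := by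
  induction x using loop_induction with
  | h0 => simpa using hasFinsum_zero
  | hadd x y hx hy => simpa only [map_add, add_smul] using hx.add hy
  | hmode n u =>
    refine hasFinsum_of_fiber n (fun i m hm => ?_) ⟨Set.toFinite _, ?_⟩
    · rw [modeCovec, pairing_modes, if_neg (by dsimp; omega), zero_smul]
    · cases nonempty_fintype ι
      rw [finsum_eq_sum_of_fintype]
      simp only [modeCovec, modeVec, pairing_modes, add_neg_cancel, if_true, ← loopMode_smul]
      rw [loopMode]
      simp_rw [loopMode]
      rw [← TensorProduct.tmul_sum]
      congr 1
      exact e.sum_repr u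

lemma hasFinsum_modeCovec (f : RestrictedDual K ℓ) :
    HasFinsum (fun a => pairing K ℓ f (modeVec e a) • modeCovec e a) f := by
  induction f using restrictedDual_induction with
  | h0 => simpa using hasFinsum_zero
  | hadd x y hx hy => simpa only [map_add, LinearMap.add_apply, add_smul] using hx.add hy
  | hmode n f =>
    refine hasFinsum_of_fiber (-n) (fun i m hm => ?_) ⟨Set.toFinite _, ?_⟩
    · rw [modeVec, pairing_modes, if_neg (by dsimp; omega), zero_smul]
    · cases nonempty_fintype ι
      rw [finsum_eq_sum_of_fintype]
      simp only [modeCovec, modeVec, pairing_modes, neg_add_cancel, if_true, ← dualMode_smul,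
        neg_neg]
      simp only [dualMode]
      rw [← map_sum, ← Finsupp.single_finsetSum]
      congr 2
      refine e.ext fun i => ?_
      simp

lemma hasFinsum_apply_modeVec {V : Type*} [AddCommGroup V] [Module K V] (L : Loop K ℓ →ₗ[K] V)
    (x : Loop K ℓ) :
    HasFinsum (fun a => pairing K ℓ (modeCovec e a) x • L (modeVec e a)) (L x) := by
  simpa only [map_smul] using (hasFinsum_modeVec e x).map L

lemma hasFinsum_apply_modeCovec {V : Type*} [AddCommGroup V] [Module K V]
    (L : RestrictedDual K ℓ →ₗ[K] V) (f : RestrictedDual K ℓ) :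
    HasFinsum (fun a => pairing K ℓ f (modeVec e a) • L (modeCovec e a)) (L f) := by
  simpa only [map_smul] using (hasFinsum_modeCovec e f).map L

end Expansions

/-! ### The Koszul differential and its brackets with the generators -/

namespace ModeRep

variable {K : Type*} [Field K] {ℓ : Type*} [LieRing ℓ] [LieAlgebra K ℓ] {ι : Type*}
  {M : Type*} [AddCommGroup M] [Module K M] (F : ModeRep K ℓ M) (e : Module.Basis ι K ℓ)

lemma c_modeCovec_eq_zero {w : M} {N : ℤ}
    (hN : ∀ n, N ≤ n → ∀ f : Module.Dual K ℓ, F.c (dualMode n f) w = 0) {a : ι × ℤ}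
    (ha : a.2 ≤ -N) : F.c (modeCovec e a) w = 0 :=
  hN _ (by omega) _

lemma β_lie_modeVec_eq_zero {w : M} {N : ℤ}
    (hN : ∀ n, N ≤ n → ∀ u : ℓ, F.β (loopMode K n u) w = 0) {a b : ι × ℤ}
    (h : N ≤ a.2 + b.2) : F.β ⁅modeVec e a, modeVec e b⁆ w = 0 := by
  rw [lie_modeVec]
  exact hN _ h _

/-- The terms `γ^{u'} b^u` of the Koszul differential. -/
noncomputable def koszulSummand (a : ι × ℤ) : Module.End K M :=
  F.γ (modeCovec e a) * F.b (modeVec e a)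

lemma koszulSummand_apply (a : ι × ℤ) (w : M) :
    F.koszulSummand e a w = F.γ (modeCovec e a) (F.b (modeVec e a) w) := rfl

variable [Finite ι]

lemma finite_modes (n m : ℤ) : {a : ι × ℤ | n ≤ a.2 ∧ a.2 ≤ m}.Finite :=
  ((Set.finite_univ (α := ι)).prod (Set.finite_Icc n m)).subset fun _ ha => ⟨trivial, ha⟩

lemma koszulSummand_locallyFinite : LocallyFinite (F.koszulSummand e) := by
  intro w
  obtain ⟨N, hN⟩ := F.exists_bound w
  refine (finite_modes (-N) N).subset fun a h => ⟨?_, ?_⟩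
  · by_contra ha
    refine h ?_
    rw [koszulSummand_apply, ← F.b_γ]
    exact (congrArg _ ((hN _ (by omega)).2 _).2).trans (map_zero _)
  · by_contra ha
    refine h ?_
    rw [koszulSummand_apply]
    exact (congrArg _ ((hN _ (by omega)).1 _).1).trans (map_zero _)

/-- The Koszul differential `∑ γ^{u'} b^u`. -/
noncomputable def koszulOp : Module.End K M :=
  locSum (F.koszulSummand e) (F.koszulSummand_locallyFinite e)

/-- In $\gamma^{u'}b^u$ only $\gamma$ fails to commute with $\beta^x$. Its contraction leaves
$\langle u',x\rangle b^u$, and these terms sum to $b^x$. -/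
lemma koszulOp_β (x : Loop K ℓ) (w : M) :
    F.koszulOp e (F.β x w) = F.β x (F.koszulOp e w) + F.b x w := by
  have h := hasFinsum_bracket (F.koszulSummand_locallyFinite e) (F.β x) 1
    (fun a => pairing K ℓ (modeCovec e a) x • F.b (modeVec e a) w) w fun a => by
      rw [koszulSummand_apply, koszulSummand_apply, F.b_β, F.γ_β, one_smul]
  rw [one_smul] at h
  have := h.unique (hasFinsum_apply_modeVec e ((F.b).flip w) x)
  exact eq_add_of_sub_eq' this

lemma koszulOp_c (f : RestrictedDual K ℓ) (w : M) :
    F.koszulOp e (F.c f w) = - F.c f (F.koszulOp e w) + F.γ f w := by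
  have h := hasFinsum_bracket (F.koszulSummand_locallyFinite e) (F.c f) (-1)
    (fun a => pairing K ℓ f (modeVec e a) • F.γ (modeCovec e a) w) w fun a => by
      rw [koszulSummand_apply, koszulSummand_apply, F.c_γ, neg_smul, one_smul, F.b_c, map_add,
        map_neg, map_smul]
  have := h.unique (hasFinsum_apply_modeCovec e ((F.γ).flip w) f)
  rw [neg_smul, one_smul] at this
  exact eq_add_of_sub_eq' this

lemma koszulOp_γ (f : RestrictedDual K ℓ) (w : M) :
    F.koszulOp e (F.γ f w) = F.γ f (F.koszulOp e w) :=
  locSum_apply_comm _ _ (fun a w => by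
    rw [koszulSummand_apply, koszulSummand_apply, F.b_γ, F.γ_γ]) w

lemma koszulOp_b (x : Loop K ℓ) (w : M) :
    F.koszulOp e (F.b x w) = - F.b x (F.koszulOp e w) :=
  locSum_apply_anticomm _ _ (fun a w => by
    rw [koszulSummand_apply, koszulSummand_apply, F.b_b, map_neg, F.b_γ]) w

/-- The operator $h$ commutes with $\gamma$ and anticommutes with $b$, so it anticommutes with each
summand of itself. Thus $h^2=-h^2$. -/
lemma koszulOp_koszulOp [CharZero K] (w : M) : F.koszulOp e (F.koszulOp e w) = 0 := by
  have h : F.koszulOp e (F.koszulOp e w) = - F.koszulOp e (F.koszulOp e w) :=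
    locSum_apply_anticomm _ (F.koszulOp e) (fun a w => by
      rw [koszulSummand_apply, koszulSummand_apply, koszulOp_γ, koszulOp_b, map_neg, neg_neg]) w
  have h2 : (2 : K) • F.koszulOp e (F.koszulOp e w) = 0 := by
    rw [two_smul]
    exact add_eq_zero_iff_eq_neg.2 h
  exact (smul_eq_zero.1 h2).resolve_left two_ne_zero

lemma koszulOp_vac : F.koszulOp e (F.vac) = 0 := by
  refine (hasFinsum_locSum (F.koszulSummand_locallyFinite e) _).unique
    (hasFinsum_zero.congr fun a => ?_)
  rw [koszulSummand_apply]
  rcases le_or_gt 0 a.2 with h | h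
  · have : F.b (modeVec e a) (F.vac) = 0 :=
      F.b_vac _ h _
    rw [this, map_zero]
  · have : F.γ (modeCovec e a) (F.vac) = 0 :=
      F.γ_vac _ (by omega) _
    rw [← F.b_γ, this, map_zero]

end ModeRep

/-! ### The twist operator and the vanishing of its double bracket with the Koszul differential -/

namespace ModeRep

variable {K : Type*} [Field K] {ℓ : Type*} [LieRing ℓ] [LieAlgebra K ℓ] {ι : Type*}
  {M : Type*} [AddCommGroup M] [Module K M] (F : ModeRep K ℓ M) (e : Module.Basis ι K ℓ)

/-- The terms `β^{[u,v]} c^{v'} c^{u'}`, for `u`, `v` in the basis of the loop algebra. -/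
noncomputable def twistTerm (p : (ι × ℤ) × (ι × ℤ)) : Module.End K (M) :=
  F.β ⁅modeVec e p.1, modeVec e p.2⁆ * F.c (modeCovec e p.2) * F.c (modeCovec e p.1)

lemma twistTerm_apply (p : (ι × ℤ) × (ι × ℤ)) (w : M) :
    F.twistTerm e p w = F.β ⁅modeVec e p.1, modeVec e p.2⁆
      (F.c (modeCovec e p.2) (F.c (modeCovec e p.1) w)) := rfl

variable [Finite ι]

/-- The three factors supercommute, so any of them can be applied first. The two $c$'s bound both
degrees from below, and $\beta$ bounds their sum from above. -/
lemma twistTerm_locallyFinite : LocallyFinite (F.twistTerm e) := by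
  intro w
  obtain ⟨N, hN⟩ := F.exists_bound w
  have hβ : ∀ n, N ≤ n → ∀ u : ℓ, F.β (loopMode K n u) w = 0 := fun n hn u => ((hN n hn).1 u).2
  have hc : ∀ n, N ≤ n → ∀ f : Module.Dual K ℓ, F.c (dualMode n f) w = 0 :=
    fun n hn f => ((hN n hn).2 f).1
  refine ((finite_modes (ι := ι) (-N) (2 * N)).prod (finite_modes (-N) (2 * N))).subset ?_
  intro p h
  have h1 : -N < p.1.2 := by
    by_contra h1
    exact h (by rw [twistTerm_apply, F.c_modeCovec_eq_zero e hc (by omega), map_zero, map_zero])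
  have h2 : -N < p.2.2 := by
    by_contra h2
    exact h (by rw [twistTerm_apply, F.c_c, F.c_modeCovec_eq_zero e hc (by omega), map_zero,
      neg_zero, map_zero])
  have h3 : p.1.2 + p.2.2 < N := by
    by_contra h3
    exact h (by rw [twistTerm_apply, ← F.c_β, ← F.c_β,
      F.β_lie_modeVec_eq_zero e hβ (by omega), map_zero, map_zero])
  simp only [Set.mem_prod, Set.mem_ofPred_eq]
  omega

/-- The operator `½ ∑ β^{[u,v]} c^{v'} c^{u'}`, which conjugates the Koszul differential into the
total differential. -/
noncomputable def twist : Module.End K (M) :=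
  (1 / 2 : K) • locSum (F.twistTerm e) (F.twistTerm_locallyFinite e)

/-- Each term of the twist operator is quadratic in $c$, so a sign between $A$ and $c$ occurs twice
and cancels. The case $r=-1$ serves odd operators and $r=1$ even ones. -/
lemma twist_apply_comm (A : Module.End K (M)) (r : K) (hr : r * r = 1)
    (hβ : ∀ x w, A (F.β x w) = F.β x (A w))
    (hc : ∀ f w, A (F.c f w) = r • F.c f (A w)) (w : M) :
    F.twist e (A w) = A (F.twist e w) := by
  rw [twist, LinearMap.smul_apply, LinearMap.smul_apply, map_smul]
  congr 1
  refine locSum_apply_comm _ A (fun p w => ?_) w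
  rw [twistTerm_apply, twistTerm_apply, hβ, hc, hc, map_smul, map_smul, map_smul,
    smul_smul, hr, one_smul]

lemma twist_β (x : Loop K ℓ) (w : M) :
    F.twist e (F.β x w) = F.β x (F.twist e w) :=
  F.twist_apply_comm e _ 1 (one_mul 1) (fun _ _ => F.β_β _ _ _)
    (fun _ _ => by rw [one_smul, F.c_β]) w

lemma twist_c (f : RestrictedDual K ℓ) (w : M) :
    F.twist e (F.c f w) = F.c f (F.twist e w) :=
  F.twist_apply_comm e _ (-1) (by ring) (fun _ _ => F.c_β _ _ _)
    (fun _ _ => by rw [neg_smul, one_smul, F.c_c]) w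

lemma twist_vac : F.twist e (F.vac) = 0 := by
  rw [twist, LinearMap.smul_apply,
    (hasFinsum_locSum (F.twistTerm_locallyFinite e) _).unique (hasFinsum_zero.congr fun p => ?_),
    smul_zero]
  have hc : ∀ a : ι × ℤ, a.2 < 0 → F.c (modeCovec e a) (F.vac) = 0 := fun a ha =>
    F.c_vac _ (by omega) _
  rw [twistTerm_apply]
  rcases lt_or_ge p.1.2 0 with h1 | h1
  · rw [hc _ h1, map_zero, map_zero]
  rcases lt_or_ge p.2.2 0 with h2 | h2
  · rw [F.c_c, hc _ h2, map_zero, neg_zero, map_zero]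
  have h3 : F.β ⁅modeVec e p.1, modeVec e p.2⁆ (F.vac) = 0 := by
    rw [lie_modeVec]
    exact F.β_vac _ (by omega) _
  rw [← F.c_β, ← F.c_β, h3, map_zero, map_zero]

/-- The brackets `[T, b^x]` of the twist operator `T`. -/
noncomputable def twistB : Loop K ℓ →ₗ[K] Module.End K (M) :=
  LinearMap.mulLeft K (F.twist e) ∘ₗ F.b - LinearMap.mulRight K (F.twist e) ∘ₗ F.b

/-- The brackets `[T, γ^f]` of the twist operator `T`. -/
noncomputable def twistΓ : RestrictedDual K ℓ →ₗ[K] Module.End K (M) :=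
  LinearMap.mulLeft K (F.twist e) ∘ₗ F.γ - LinearMap.mulRight K (F.twist e) ∘ₗ F.γ

lemma twistB_apply (x : Loop K ℓ) (w : M) :
    F.twistB e x w = F.twist e (F.b x w) - F.b x (F.twist e w) := rfl

lemma twistΓ_apply (f : RestrictedDual K ℓ) (w : M) :
    F.twistΓ e f w = F.twist e (F.γ f w) - F.γ f (F.twist e w) := rfl

lemma twistB_β (x y : Loop K ℓ) (w : M) :
    F.twistB e x (F.β y w) = F.β y (F.twistB e x w) := by
  simp only [twistB_apply, F.b_β, twist_β, map_sub]

lemma twistB_c (x : Loop K ℓ) (f : RestrictedDual K ℓ) (w : M) :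
    F.twistB e x (F.c f w) = - F.c f (F.twistB e x w) := by
  simp only [twistB_apply, F.b_c, twist_c, map_sub, map_add, map_neg, map_smul]
  abel

lemma twistΓ_β (f : RestrictedDual K ℓ) (y : Loop K ℓ) (w : M) :
    F.twistΓ e f (F.β y w) = F.β y (F.twistΓ e f w) := by
  simp only [twistΓ_apply, F.γ_β, twist_β, map_sub, map_add, map_smul]
  abel

lemma twistΓ_c (f g : RestrictedDual K ℓ) (w : M) :
    F.twistΓ e f (F.c g w) = F.c g (F.twistΓ e f w) := by
  simp only [twistΓ_apply, ← F.c_γ, twist_c, map_sub]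

/-- The bracket $[T,b^x]$ commutes with $\beta$ and anticommutes with $c$, as an odd expression in
$\beta$ and $c$ alone would. This suffices for $[T,[T,b^x]]=0$, with no need for an explicit
formula. -/
lemma twist_twistB (x : Loop K ℓ) (w : M) :
    F.twist e (F.twistB e x w) = F.twistB e x (F.twist e w) :=
  F.twist_apply_comm e _ (-1) (by ring) (fun _ _ => F.twistB_β _ _ _ _)
    (fun _ _ => by rw [neg_smul, one_smul, twistB_c]) w

lemma twist_twistΓ (f : RestrictedDual K ℓ) (w : M) :
    F.twist e (F.twistΓ e f w) = F.twistΓ e f (F.twist e w) :=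
  F.twist_apply_comm e _ 1 (one_mul 1) (fun _ _ => F.twistΓ_β _ _ _ _)
    (fun _ _ => by rw [one_smul, twistΓ_c]) w

/-- The only contraction is of $\gamma^f$ with $\beta^{[u,v]}$. It replaces $\beta$ by the scalar
$-\langle f,[u,v]\rangle$ and leaves a quadratic expression in $c$. -/
lemma hasFinsum_twistΓ (f : RestrictedDual K ℓ) (w : M) :
    HasFinsum (fun p : (ι × ℤ) × (ι × ℤ) =>
      (-(1 / 2) : K) • pairing K ℓ f ⁅modeVec e p.1, modeVec e p.2⁆ •
        F.c (modeCovec e p.2) (F.c (modeCovec e p.1) w)) (F.twistΓ e f w) := by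
  have h := hasFinsum_bracket (F.twistTerm_locallyFinite e) (F.γ f) (1 : K)
    (fun p => -(pairing K ℓ f ⁅modeVec e p.1, modeVec e p.2⁆ •
        F.c (modeCovec e p.2) (F.c (modeCovec e p.1) w))) w fun p => by
      rw [twistTerm_apply, twistTerm_apply, F.c_γ, F.c_γ, F.γ_β, one_smul]
      abel
  have h2 := (h.smul (1 / 2 : K)).congr (g := fun p : (ι × ℤ) × (ι × ℤ) =>
      (-(1 / 2) : K) • pairing K ℓ f ⁅modeVec e p.1, modeVec e p.2⁆ •
        F.c (modeCovec e p.2) (F.c (modeCovec e p.1) w))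
    fun p => by rw [smul_neg, neg_smul]
  rwa [one_smul, smul_sub, ← map_smul (F.γ f)] at h2

variable [CharZero K]

/-- Contracting $b^x$ with either $c$ gives the same total after exchanging the two summation
indices and using antisymmetry of the bracket. This doubling absorbs the factor $\frac12$ in the
twist operator. -/
lemma hasFinsum_twistB (x : Loop K ℓ) (w : M) :
    HasFinsum (fun d => F.β ⁅x, modeVec e d⁆ (F.c (modeCovec e d) w))
      (F.twistB e x w) := by
  let G : (ι × ℤ) × (ι × ℤ) → M := fun p =>
    pairing K ℓ (modeCovec e p.2) x •
      F.β ⁅modeVec e p.2, modeVec e p.1⁆ (F.c (modeCovec e p.1) w)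
  have h := hasFinsum_bracket (F.twistTerm_locallyFinite e) (F.b x) (1 : K)
    (fun p => G p.swap + G p) w fun p => by
      have hs : ⁅modeVec e p.2, modeVec e p.1⁆ = -⁅modeVec e p.1, modeVec e p.2⁆ :=
        (lie_skew _ _).symm
      simp only [twistTerm_apply, G, Prod.fst_swap, Prod.snd_swap, hs, F.c_b, map_add, map_neg,
        map_smul, F.b_β, LinearMap.neg_apply, one_smul, smul_neg]
      abel
  have hF : G.support.Finite := by
    obtain ⟨N, hN⟩ := F.exists_bound w
    have hβ : ∀ n, N ≤ n → ∀ u : ℓ, F.β (loopMode K n u) w = 0 := fun n hn u => ((hN n hn).1 u).2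
    have hc : ∀ n, N ≤ n → ∀ f : Module.Dual K ℓ, F.c (dualMode n f) w = 0 :=
      fun n hn f => ((hN n hn).2 f).1
    have hU := finite_pairing_modeVec e x
    obtain ⟨m, hm⟩ := (hU.image Prod.snd).bddBelow
    refine ((finite_modes (-N) (N - m)).prod hU).subset fun p hp => ?_
    have h1 : pairing K ℓ (modeCovec e p.2) x ≠ 0 := fun h1 => hp (by simp only [G, h1, zero_smul])
    have h2 : m ≤ p.2.2 := hm ⟨p.2, h1, rfl⟩
    refine ⟨⟨?_, ?_⟩, h1⟩
    · by_contra h3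
      exact hp (by simp only [G]; rw [F.c_modeCovec_eq_zero e hc (by omega), map_zero, smul_zero])
    · by_contra h3
      exact hp (by
        simp only [G]
        rw [← F.c_β, F.β_lie_modeVec_eq_zero e hβ (by omega), map_zero, smul_zero])
  have hF1 := hasFinsum_of_finite hF
  have hF2 := (hF1.equiv (Equiv.prodComm _ _)).add hF1
  have hs := h.unique hF2
  have hB : F.twistB e x w = ∑ᶠ p, G p := by
    rw [twistB_apply, twist, LinearMap.smul_apply, LinearMap.smul_apply, map_smul, ← smul_sub]
    rw [one_smul] at hs
    rw [hs, ← two_smul K, smul_smul]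
    norm_num
  rw [hB]
  refine hF1.prod fun d => ?_
  -- With $d$ fixed, the remaining sum is the expansion of $x$ under the linear map
  -- $y\mapsto\beta^{[y,d]}$, written as $\beta\circ(-\mathrm{ad}\,d)$.
  have hd := hasFinsum_apply_modeVec e ((F.β ∘ₗ
    (-(LieAlgebra.ad K (Loop K ℓ) (modeVec e d) : Module.End K (Loop K ℓ)))).flip
      (F.c (modeCovec e d) w)) x
  simp only [LinearMap.flip_apply, LinearMap.comp_apply, LinearMap.neg_apply, LieAlgebra.ad_apply,
    lie_skew] at hd
  exact hd

/-- If $a$ has degree at least $2N$, then in each term of $[T,b^a]w$ either the degree of $d$ is at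
most $-N$ and $c^{d'}$ kills $w$, or the degree of $[a,d]$ exceeds $N$ and $\beta$ does. -/
lemma finite_support_twistB (w : M) :
    ∃ m : ℤ, ∀ a : ι × ℤ, m ≤ a.2 → F.twistB e (modeVec e a) w = 0 := by
  obtain ⟨N, hN⟩ := F.exists_bound w
  refine ⟨2 * N, fun a ha => (F.hasFinsum_twistB e (modeVec e a) w).unique
    (hasFinsum_zero.congr fun d => ?_)⟩
  rcases le_or_gt d.2 (-N) with h | h
  · rw [F.c_modeCovec_eq_zero e (fun n hn f => ((hN n hn).2 f).1) h, map_zero]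
  · rw [← F.c_β, F.β_lie_modeVec_eq_zero e (fun n hn u => ((hN n hn).1 u).2) (by omega), map_zero]

/-- This is the Jacobi identity in operator form. Expanding $[T,b]$ gives a triple sum of
$\beta^{[[x,y],z]}c^{y'}c^{x'}c^{z'}$. The product of three $c$'s is invariant under cyclic
permutations, so three times the sum is a sum of Jacobi expressions. -/
lemma hasFinsum_twistB_lie (w : M) :
    HasFinsum (fun p : (ι × ℤ) × (ι × ℤ) => F.c (modeCovec e p.2) (F.c (modeCovec e p.1)
      (F.twistB e ⁅modeVec e p.1, modeVec e p.2⁆ w))) 0 := by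
  let G : ((ι × ℤ) × (ι × ℤ)) × (ι × ℤ) → M := fun q =>
    F.β ⁅⁅modeVec e q.1.1, modeVec e q.1.2⁆, modeVec e q.2⁆
      (F.c (modeCovec e q.1.2) (F.c (modeCovec e q.1.1) (F.c (modeCovec e q.2) w)))
  -- The cyclic permutation of the three summation indices.
  let ρ : ((ι × ℤ) × (ι × ℤ)) × (ι × ℤ) ≃ ((ι × ℤ) × (ι × ℤ)) × (ι × ℤ) :=
    { toFun := fun q => ((q.1.2, q.2), q.1.1)
      invFun := fun q => ((q.2, q.1.1), q.1.2)
      left_inv := fun _ => rfl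
      right_inv := fun _ => rfl }
  have hc1 : ∀ {a b c : ι × ℤ}, F.c (modeCovec e b) (F.c (modeCovec e a) (F.c (modeCovec e c) w)) =
      F.c (modeCovec e c) (F.c (modeCovec e b) (F.c (modeCovec e a) w)) := by
    intro a b c
    rw [F.c_c (modeCovec e a), map_neg, F.c_c (modeCovec e b), neg_neg]
  have hG : G.support.Finite := by
    obtain ⟨N, hN⟩ := F.exists_bound w
    have hc : ∀ {a : ι × ℤ}, a.2 ≤ -N → F.c (modeCovec e a) w = 0 := fun h =>
      F.c_modeCovec_eq_zero e (fun n hn f => ((hN n hn).2 f).1) h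
    refine (((finite_modes (-N) (3 * N)).prod (finite_modes (-N) (3 * N))).prod
      (finite_modes (ι := ι) (-N) (3 * N))).subset fun q hq => ?_
    have h1 : -N < q.2.2 := by
      by_contra h
      exact hq (by simp only [G]; rw [hc (by omega)]; simp only [map_zero])
    have h2 : -N < q.1.1.2 := by
      by_contra h
      exact hq (by simp only [G]; rw [hc1, hc (by omega)]; simp only [map_zero])
    have h3 : -N < q.1.2.2 := by
      by_contra h
      exact hq (by simp only [G]; rw [hc1, hc1, hc (by omega)]; simp only [map_zero])
    have h4 : q.1.1.2 + q.1.2.2 + q.2.2 < N := by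
      by_contra h
      refine hq ?_
      simp only [G]
      rw [lie_modeVec, modeVec, lie_loopMode, ← F.c_β, ← F.c_β, ← F.c_β,
        ((hN _ (by omega)).1 _).2]
      simp only [map_zero]
    simp only [Set.mem_prod, Set.mem_ofPred_eq]
    omega
  have h1 := hasFinsum_of_finite hG
  have h0 : HasFinsum (fun _ => (0 : M)) ((∑ᶠ q, G q) + (∑ᶠ q, G q) + ∑ᶠ q, G q) :=
    ((h1.add (h1.equiv ρ)).add (h1.equiv (ρ.trans ρ))).congr fun q => by
      simp only [G, ρ, Equiv.trans_apply, Equiv.coe_fn_mk]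
      rw [hc1 (a := q.1.2) (b := q.2) (c := q.1.1), hc1 (a := q.2) (b := q.1.1) (c := q.1.2),
        ← LinearMap.add_apply, ← LinearMap.add_apply,
        ← map_add, ← map_add]
      have hJ : ⁅⁅modeVec e q.1.1, modeVec e q.1.2⁆, modeVec e q.2⁆ +
          ⁅⁅modeVec e q.1.2, modeVec e q.2⁆, modeVec e q.1.1⁆ +
          ⁅⁅modeVec e q.2, modeVec e q.1.1⁆, modeVec e q.1.2⁆ = 0 := by
        rw [← neg_eq_zero, neg_add, neg_add, lie_skew, lie_skew, lie_skew, add_assoc, add_comm]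
        exact lie_jacobi _ _ _
      rw [hJ, map_zero, LinearMap.zero_apply]
  have hzero : ∑ᶠ q, G q = 0 := by
    have h3 : (3 : K) • ∑ᶠ q, G q = 0 := by
      rw [← h0.unique hasFinsum_zero, show (3 : K) = 1 + 1 + 1 by norm_num, add_smul, add_smul,
        one_smul]
    exact (smul_eq_zero.1 h3).resolve_left three_ne_zero
  rw [hzero] at h1
  refine h1.prod fun p => ?_
  refine ((F.hasFinsum_twistB e _ w).map
    (F.c (modeCovec e p.2) * F.c (modeCovec e p.1))).congr fun d => ?_
  simp only [G, Module.End.mul_apply, F.c_β]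

/-- The terms $\langle a',[x,y]\rangle c^{y'}c^{x'}[T,b^a]w$ are summed in two orders. Summing over
$a$ first gives $c^{y'}c^{x'}[T,b^{[x,y]}]w$, whose total is zero by the Jacobi identity. Summing
over $x,y$ first gives multiples of $[T,\gamma^{a'}][T,b^a]w$. -/
lemma hasFinsum_twistΓ_twistB (w : M) :
    HasFinsum (fun a => F.twistΓ e (modeCovec e a) (F.twistB e (modeVec e a) w)) 0 := by
  let G : (ι × ℤ) × ((ι × ℤ) × (ι × ℤ)) → M := fun q =>
    pairing K ℓ (modeCovec e q.1) ⁅modeVec e q.2.1, modeVec e q.2.2⁆ •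
      F.c (modeCovec e q.2.2) (F.c (modeCovec e q.2.1) (F.twistB e (modeVec e q.1) w))
  have hG : G.support.Finite := by
    obtain ⟨N, hN⟩ := F.exists_bound w
    obtain ⟨m, hm⟩ := F.finite_support_twistB e w
    have hc : ∀ {a : ι × ℤ}, a.2 ≤ -N → F.c (modeCovec e a) w = 0 := fun h =>
      F.c_modeCovec_eq_zero e (fun n hn f => ((hN n hn).2 f).1) h
    refine ((finite_modes (ι := ι) (-2 * N) m).prod ((finite_modes (-N) (m + N)).prod
      (finite_modes (-N) (m + N)))).subset fun q hq => ?_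
    have h1 : q.1.2 < m := by
      by_contra h
      exact hq (by simp only [G]; rw [hm _ (by omega)]; simp only [map_zero, smul_zero])
    have h2 : -N < q.2.1.2 := by
      by_contra h
      refine hq ?_
      have := F.twistB_c e (modeVec e q.1) (modeCovec e q.2.1) w
      rw [hc (by omega), map_zero, eq_comm, neg_eq_zero] at this
      simp only [G, this, map_zero, smul_zero]
    have h3 : -N < q.2.2.2 := by
      by_contra h
      refine hq ?_
      have := F.twistB_c e (modeVec e q.1) (modeCovec e q.2.2) w
      rw [hc (by omega), map_zero, eq_comm, neg_eq_zero] at this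
      simp only [G]
      rw [F.c_c, this, map_zero, neg_zero, smul_zero]
    have h4 : q.2.1.2 + q.2.2.2 = q.1.2 := by
      by_contra h
      refine hq ?_
      simp only [G]
      rw [lie_modeVec, modeCovec, pairing_modes, if_neg (by omega), zero_smul]
    simp only [Set.mem_prod, Set.mem_ofPred_eq]
    omega
  have h1 := hasFinsum_of_finite hG
  have h2 := (h1.equiv (Equiv.prodComm _ _)).prod fun p => by
    have := hasFinsum_apply_modeVec e ((F.c (modeCovec e p.2) * F.c (modeCovec e p.1)) ∘ₗ
      (F.twistB e).flip w) ⁅modeVec e p.1, modeVec e p.2⁆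
    exact this
  have h3 := h2.unique (F.hasFinsum_twistB_lie e w)
  rw [h3] at h1
  -- The factor $-2$ inverts the coefficient $-\frac12$ in the formula for $[T,\gamma]$.
  have h4 := h1.prod (g := fun a => (-2 : K) •
      F.twistΓ e (modeCovec e a) (F.twistB e (modeVec e a) w)) fun a =>
    ((F.hasFinsum_twistΓ e (modeCovec e a) (F.twistB e (modeVec e a) w)).smul (-2 : K)).congr
      fun p => by
        simp only [G]
        rw [smul_smul (-2 : K)]
        norm_num
  have h5 := h4.smul (-(1 / 2) : K)
  rw [smul_zero] at h5
  exact h5.congr fun a => by rw [smul_smul]; norm_num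

/-- The double commutator of the Koszul differential with the twist operator vanishes. -/
lemma koszulOp_twist_twist (w : M) :
    F.koszulOp e (F.twist e (F.twist e w)) - (2 : K) • F.twist e (F.koszulOp e (F.twist e w)) +
      F.twist e (F.twist e (F.koszulOp e w)) = 0 := by
  have hh := hasFinsum_locSum (F.koszulSummand_locallyFinite e)
  have h1 := ((hh (F.twist e (F.twist e w))).sub
    (((hh (F.twist e w)).map (F.twist e)).smul (2 : K))).add
    (((hh w).map (F.twist e)).map (F.twist e))
  refine h1.unique ?_
  have h2 := (F.hasFinsum_twistΓ_twistB e w).smul (2 : K)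
  rw [smul_zero] at h2
  refine h2.congr fun a => ?_
  -- These are the relations $[T,[T,b]]=0$ and $[T,[T,\gamma]]=0$ solved for $TTb$ and $TT\gamma$.
  -- Substituting them turns each summand of the double bracket of $\gamma b$ into
  -- $2[T,\gamma][T,b]$.
  have hB : ∀ y, F.twist e (F.twist e (F.b (modeVec e a) y)) =
      (2 : K) • F.twist e (F.b (modeVec e a) (F.twist e y)) -
        F.b (modeVec e a) (F.twist e (F.twist e y)) := fun y => by
    have := F.twist_twistB e (modeVec e a) y
    simp only [twistB_apply, map_sub] at this
    rw [sub_eq_iff_eq_add.1 this, two_smul]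
    abel
  have hΓ : ∀ y, F.twist e (F.twist e (F.γ (modeCovec e a) y)) =
      (2 : K) • F.twist e (F.γ (modeCovec e a) (F.twist e y)) -
        F.γ (modeCovec e a) (F.twist e (F.twist e y)) := fun y => by
    have := F.twist_twistΓ e (modeCovec e a) y
    simp only [twistΓ_apply, map_sub] at this
    rw [sub_eq_iff_eq_add.1 this, two_smul]
    abel
  simp only [koszulSummand_apply, twistΓ_apply, twistB_apply, hB, hΓ, map_sub, map_add, smul_sub,
    two_smul]
  abel

end ModeRep
lemma HasFinsum.of_injective {M I J : Type*} [AddCommGroup M] {σ : J → I}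
    (hσ : Function.Injective σ) {g : I → M} {s : M} (h0 : ∀ i, i ∉ Set.range σ → g i = 0)
    (h : HasFinsum (fun j => g (σ j)) s) : HasFinsum g s := by
  refine ⟨(h.1.image σ).subset fun i hi => ?_, ?_⟩
  · by_contra hn
    refine hi (h0 i ?_)
    rintro ⟨j, rfl⟩
    exact hn ⟨j, hi, rfl⟩
  · rw [← h.2, ← finsum_mem_range hσ]
    refine finsum_congr fun i => ?_
    by_cases hi : i ∈ Set.range σ
    · simp only [hi, finsum_true]
    · simp only [hi, finsum_false, h0 i hi]

/-! ### The exponential of a locally nilpotent operator -/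

section LocalExp

variable {K : Type*} [Field K] {M : Type*} [AddCommGroup M] [Module K M]

/-- An operator is locally nilpotent if every vector is killed by one of its powers. -/
def LocallyNilpotent (T : Module.End K M) : Prop := ∀ w, ∃ k : ℕ, (T ^ k) w = 0

lemma pow_apply_eq_zero_of_le {T : Module.End K M} {w : M} {k m : ℕ} (h : (T ^ k) w = 0)
    (hkm : k ≤ m) : (T ^ m) w = 0 := by
  obtain ⟨d, rfl⟩ := Nat.exists_eq_add_of_le' hkm
  rw [pow_add, Module.End.mul_apply, h, map_zero]

lemma LocallyNilpotent.locallyFinite {T : Module.End K M} (hT : LocallyNilpotent T) :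
    LocallyFinite (fun k : ℕ => (k.factorial : K)⁻¹ • T ^ k) := by
  intro w
  obtain ⟨k, hk⟩ := hT w
  refine (Set.finite_lt_nat k).subset fun m hm => ?_
  by_contra h
  exact hm (by
    rw [LinearMap.smul_apply, pow_apply_eq_zero_of_le hk (not_lt.1 h), smul_zero])

/-- The exponential of a locally nilpotent operator. -/
noncomputable def localExp {T : Module.End K M} (hT : LocallyNilpotent T) : Module.End K M :=
  locSum _ hT.locallyFinite

/-- On a vector killed by $T^{k+1}$, the operator $T^k$ sees only the constant term of the
exponential series. This gives bijectivity of $e^T$ by induction on the nilpotency exponent, without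
constructing $e^{-T}$. -/
lemma pow_apply_localExp {T : Module.End K M} (hT : LocallyNilpotent T) {k : ℕ} {w : M}
    (hw : (T ^ (k + 1)) w = 0) : (T ^ k) (localExp hT w) = (T ^ k) w := by
  have h := (hasFinsum_locSum hT.locallyFinite w).map (T ^ k)
  refine h.unique ⟨(Set.finite_singleton 0).subset fun m hm => ?_, ?_⟩
  · by_contra h0
    refine hm ?_
    beta_reduce
    rw [LinearMap.smul_apply, map_smul, ← Module.End.mul_apply, ← pow_add,
      pow_apply_eq_zero_of_le hw (by simp only [Set.mem_singleton_iff] at h0; omega), smul_zero]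
  · rw [finsum_eq_single _ 0 fun m h0 => by
      rw [LinearMap.smul_apply, map_smul, ← Module.End.mul_apply, ← pow_add,
        pow_apply_eq_zero_of_le hw (by omega), smul_zero]]
    simp

lemma localExp_apply_of_eq_zero {T : Module.End K M} (hT : LocallyNilpotent T) {w : M}
    (hw : T w = 0) : localExp hT w = w := by
  simpa using pow_apply_localExp hT (k := 0) (by simpa using hw)

lemma localExp_injective {T : Module.End K M} (hT : LocallyNilpotent T) :
    Function.Injective (localExp hT) := by
  rw [← LinearMap.ker_eq_bot, LinearMap.ker_eq_bot']
  intro w hw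
  obtain ⟨k, hk⟩ := hT w
  induction k with
  | zero => simpa using hk
  | succ k ih =>
    refine ih ?_
    rw [← pow_apply_localExp hT hk, hw, map_zero]

lemma localExp_surjective {T : Module.End K M} (hT : LocallyNilpotent T) :
    Function.Surjective (localExp hT) := by
  intro w
  obtain ⟨k, hk⟩ := hT w
  induction k generalizing w with
  | zero => exact ⟨0, by rw [map_zero]; simpa using hk.symm⟩
  | succ k ih =>
    -- The difference $w-e^Tw$ has a smaller nilpotency exponent. If it equals $e^Tz$, then
    -- $w=e^T(z+w)$.
    obtain ⟨z, hz⟩ := ih (w - localExp hT w) (by rw [map_sub, pow_apply_localExp hT hk, sub_self])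
    exact ⟨z + w, by rw [map_add, hz, sub_add_cancel]⟩

/-- If the bracket `h T - T h` commutes with `T`, then `exp T` conjugates `h` into
`h + (h T - T h)`. -/
lemma apply_localExp [CharZero K] {T : Module.End K M} (hT : LocallyNilpotent T)
    (h : Module.End K M) (hc : Commute T (h * T - T * h)) (w : M) :
    h (localExp hT w) = localExp hT ((h * T - T * h + h) w) := by
  -- The derivation rule for $[h,T^k]$. At $k=0$ the truncated exponent $k-1$ is harmless because
  -- its coefficient is zero.
  have hpow : ∀ k : ℕ, h * T ^ k = T ^ k * h + (k : K) • (T ^ (k - 1) * (h * T - T * h)) := by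
    intro k
    induction k with
    | zero => simp
    | succ k ih =>
      have h2 : T ^ (k - 1) * (h * T - T * h) * T = T ^ (k - 1) * T * (h * T - T * h) := by
        rw [mul_assoc, ← hc.eq, mul_assoc]
      have h3 : (k : K) • (T ^ (k - 1) * T * (h * T - T * h)) =
          (k : K) • (T ^ k * (h * T - T * h)) := by
        rcases k with _ | k
        · simp
        · rw [Nat.add_sub_cancel, ← pow_succ]
      rw [pow_succ, ← mul_assoc, ih, add_mul, smul_mul_assoc, h2, h3, Nat.add_sub_cancel,
        Nat.cast_succ, add_smul, one_smul]
      noncomm_ring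
  have hL := ((hasFinsum_locSum hT.locallyFinite w).map h)
  have hR1 := hasFinsum_locSum hT.locallyFinite (h w)
  have hR2 := hasFinsum_locSum hT.locallyFinite ((h * T - T * h) w)
  have hs := hL.sub hR1
  -- The exponential series shifted by one, with a zero in degree $0$. It matches the brackets
  -- $[h,T^k]/k!=T^{k-1}[h,T]/(k-1)!$.
  have hs' : HasFinsum (fun k : ℕ => if k = 0 then 0 else
      (((k - 1).factorial : K)⁻¹ • T ^ (k - 1)) ((h * T - T * h) w))
      (localExp hT ((h * T - T * h) w)) := by
    refine HasFinsum.of_injective Nat.succ_injective (fun i hi => ?_) ?_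
    · rcases i with _ | i
      · exact if_pos rfl
      · exact absurd ⟨i, rfl⟩ hi
    · exact hR2.congr fun i => by rw [if_neg (Nat.succ_ne_zero i), Nat.succ_sub_one]
  have := hs.unique (hs'.congr fun k => ?_)
  · rw [LinearMap.add_apply, map_add, ← this]
    simp only [localExp]
    abel
  · rcases k with _ | k
    · simp
    · have hk : (((k + 1).factorial : K))⁻¹ * ((k + 1 : ℕ) : K) = (k.factorial : K)⁻¹ := by
        rw [Nat.factorial_succ, Nat.cast_mul, mul_inv, mul_comm, ← mul_assoc,
          mul_inv_cancel₀ (Nat.cast_ne_zero.2 (Nat.succ_ne_zero k)), one_mul]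
      rw [if_neg (Nat.succ_ne_zero k), LinearMap.smul_apply, map_smul, ← Module.End.mul_apply,
        hpow, LinearMap.add_apply, smul_add, LinearMap.smul_apply, smul_smul, hk,
        LinearMap.smul_apply, LinearMap.smul_apply, Nat.add_sub_cancel, Module.End.mul_apply,
        Module.End.mul_apply, add_sub_cancel_left]

end LocalExp

/-! ### Local nilpotence of the twist operator -/

namespace ModeRep

variable {K : Type*} [Field K] {ℓ : Type*} [LieRing ℓ] [LieAlgebra K ℓ] {ι : Type*}
  {M : Type*} [AddCommGroup M] [Module K M] (F : ModeRep K ℓ M) (e : Module.Basis ι K ℓ)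
  [Finite ι]

/-- When $R=[T,A]$ commutes with $T$, one has $T^kA=AT^k+kRT^{k-1}$. So $A$ preserves the vectors on
which $T$ is nilpotent. -/
lemma exists_pow_twist_eq_zero {A R : Module.End K M}
    (hR : ∀ w, F.twist e (A w) = A (F.twist e w) + R w)
    (hTR : ∀ w, F.twist e (R w) = R (F.twist e w)) {w : M}
    (hw : ∃ k : ℕ, (F.twist e ^ k) w = 0) : ∃ k : ℕ, (F.twist e ^ k) (A w) = 0 := by
  have hpow : ∀ k w, (F.twist e ^ k) (R w) = R ((F.twist e ^ k) w) := fun k w => by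
    have : Commute (F.twist e) R := LinearMap.ext hTR
    exact LinearMap.congr_fun (this.pow_left k).eq w
  obtain ⟨k, hk⟩ := hw
  induction k generalizing w with
  | zero => exact ⟨0, by simpa using congrArg A hk⟩
  | succ k ih =>
    rw [pow_succ, Module.End.mul_apply] at hk
    obtain ⟨m, hm⟩ := ih hk
    -- One factor $T$ is moved past $A$. The remaining power $m+k+1$ kills both $A(Tw)$, by the
    -- choice of $m$, and $Rw$, since $T^{k+1}w=0$.
    refine ⟨m + k + 1 + 1, ?_⟩
    rw [pow_succ, Module.End.mul_apply, hR, map_add, hpow]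
    rw [pow_apply_eq_zero_of_le hm (by omega), ← hpow, zero_add]
    rw [show m + k + 1 = m + (k + 1) by ring, pow_add, Module.End.mul_apply, hpow, pow_succ,
      Module.End.mul_apply, hk, map_zero, map_zero]

lemma twist_locallyNilpotent : LocallyNilpotent (F.twist e) := by
  let P : Submodule K M :=
    { carrier := {w | ∃ k : ℕ, (F.twist e ^ k) w = 0}
      zero_mem' := ⟨0, map_zero _⟩
      add_mem' := by
        rintro x y ⟨k, hk⟩ ⟨m, hm⟩
        exact ⟨k + m, by rw [map_add, pow_apply_eq_zero_of_le hk (by omega),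
          pow_apply_eq_zero_of_le hm (by omega), add_zero]⟩
      smul_mem' := by
        rintro r x ⟨k, hk⟩
        exact ⟨k, by rw [map_smul, hk, smul_zero]⟩ }
  have hP : P = ⊤ := by
    refine F.eq_top_of_stable P ⟨1, by rw [pow_one, F.twist_vac]⟩ ?_ ?_ ?_ ?_
    · exact fun n u w hw => F.exists_pow_twist_eq_zero e (R := F.twistB e (loopMode K n u))
        (fun w => by rw [twistB_apply]; abel) (F.twist_twistB e _) hw
    · exact fun n f w hw => F.exists_pow_twist_eq_zero e (R := 0)
        (fun w => by rw [F.twist_c]; simp) (fun w => by simp) hw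
    · exact fun n u w hw => F.exists_pow_twist_eq_zero e (R := 0)
        (fun w => by rw [F.twist_β]; simp) (fun w => by simp) hw
    · exact fun n f w hw => F.exists_pow_twist_eq_zero e (R := F.twistΓ e (dualMode n f))
        (fun w => by rw [twistΓ_apply]; abel) (F.twist_twistΓ e _) hw
  intro w
  have : w ∈ P := hP ▸ Submodule.mem_top
  exact this

end ModeRep
-- Homology from a homotopy
open Polynomial in
/-- Homology of a differential `h` for which `h k + k h` has, modulo the line of a vector `v`,
only non-zero eigenvalues. -/
lemma homology_of_homotopy {K M : Type*} [Field K] [AddCommGroup M] [Module K M]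
    {h k : Module.End K M} {v : M} (hh : ∀ w, h (h w) = 0) (hv : h v = 0) (kv : k v = 0)
    (hN : ∀ w, ∃ p : K[X], p.eval 0 ≠ 0 ∧ ∃ r : K, aeval (h * k + k * h) p w = r • v) :
    (∀ x, h x = 0 → ∃ (z : M) (r : K), x = h z + r • v) ∧ (v ≠ 0 → ∀ z, h z ≠ v) := by
  set N := h * k + k * h with hNdef
  have hNh : Commute N h := by
    refine LinearMap.ext fun w => ?_
    simp [hNdef, hh]
  have hNv : N v = 0 := by simp [hNdef, hv, kv]
  have haev : ∀ p : K[X], aeval N p v = p.eval 0 • v := fun p => by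
    conv_lhs => rw [← p.divX_mul_X_add]
    simp [hNv, coeff_zero_eq_eval_zero, Algebra.algebraMap_eq_smul_one]
  -- Splitting $p=X\cdot p_1+p(0)$ inverts $N$ modulo the line of $v$, without an eigenspace
  -- decomposition.
  have hdiv : ∀ (p : K[X]) (w : M), aeval N p w = N (aeval N p.divX w) + p.eval 0 • w :=
    fun p w => by
      conv_lhs => rw [← p.divX_mul_X_add, mul_comm]
      simp [coeff_zero_eq_eval_zero, Algebra.algebraMap_eq_smul_one]
  have hker : ∀ x, N x = 0 → ∃ r : K, x = r • v := fun x hx => by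
    obtain ⟨p, hp, r, hr⟩ := hN x
    rw [← p.divX_mul_X_add] at hr
    simp [hx, coeff_zero_eq_eval_zero, Algebra.algebraMap_eq_smul_one] at hr
    exact ⟨(p.eval 0)⁻¹ * r, by rw [mul_smul, ← hr, smul_smul, inv_mul_cancel₀ hp, one_smul]⟩
  constructor
  · intro x hx
    obtain ⟨p, hp, r, hr⟩ := hN x
    rw [hdiv] at hr
    set y := aeval N p.divX x
    -- Since $Ny=rv-p(0)x$ is killed by $h$, the vector $hy$ lies in $\ker N=Kv$. Then $khy=0$, so
    -- $Ny=hky$ is a boundary.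
    have hy : N (h y) = 0 := by
      have h1 := congrArg h hr
      rw [map_add, map_smul, map_smul, hx, hv, smul_zero, smul_zero, add_zero] at h1
      rw [← h1]
      exact LinearMap.congr_fun hNh.eq y
    obtain ⟨μ, hμ⟩ := hker _ hy
    have hNy : N y = h (k y) := by
      simp [hNdef, hμ, kv]
    refine ⟨-((p.eval 0)⁻¹ • k y), (p.eval 0)⁻¹ * r, ?_⟩
    rw [mul_smul, ← hr, hNy, smul_add, smul_smul, inv_mul_cancel₀ hp, one_smul, map_neg, map_smul]
    abel
  · intro hv0 z hz
    obtain ⟨p, hp, r, hr⟩ := hN z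
    -- If $hz=v$, then $p(0)v=p(N)hz=h\,p(N)z=r\,hv=0$.
    have h1 : aeval N p (h z) = h (aeval N p z) := by
      have : Commute (aeval N p) h := by
        exact (Algebra.commute_of_mem_adjoin_singleton_of_commute
          (aeval_mem_adjoin_singleton K N) hNh.symm).symm
      exact LinearMap.congr_fun this.eq z
    rw [hz, haev, hr, map_smul, hv, smul_zero] at h1
    exact (smul_eq_zero.1 h1).elim hp hv0

/-! ### The contracting homotopy and the number operator -/

namespace ModeRep

variable {K : Type*} [Field K] {ℓ : Type*} [LieRing ℓ] [LieAlgebra K ℓ] {ι : Type*}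
  {M : Type*} [AddCommGroup M] [Module K M] (F : ModeRep K ℓ M) (e : Module.Basis ι K ℓ)

/-- The sign of a mode in the contracting homotopy of the Koszul differential. -/
def modeSign (K : Type*) [Field K] (n : ℤ) : K := if n < 0 then 1 else -1

/-- The terms of the contracting homotopy of the Koszul differential. -/
noncomputable def homotopyTerm (a : ι × ℤ) : Module.End K M :=
  modeSign K a.2 • (F.β (modeVec e a) * F.c (modeCovec e a))

lemma homotopyTerm_apply (a : ι × ℤ) (w : M) :
    F.homotopyTerm e a w = modeSign K a.2 • F.β (modeVec e a) (F.c (modeCovec e a) w) := rfl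

variable [Finite ι]

lemma homotopyTerm_locallyFinite : LocallyFinite (F.homotopyTerm e) := by
  intro w
  obtain ⟨N, hN⟩ := F.exists_bound w
  refine (finite_modes (-N) N).subset fun a h => ⟨?_, ?_⟩
  · by_contra ha
    refine h ?_
    rw [homotopyTerm_apply, F.c_modeCovec_eq_zero e (fun n hn f => ((hN n hn).2 f).1) (by omega),
      map_zero, smul_zero]
  · by_contra ha
    refine h ?_
    rw [homotopyTerm_apply, ← F.c_β]
    have : F.β (modeVec e a) w = 0 := ((hN _ (by omega)).1 _).2
    rw [this, map_zero, smul_zero]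

/-- The contracting homotopy of the Koszul differential. -/
noncomputable def homotopy : Module.End K M :=
  locSum (F.homotopyTerm e) (F.homotopyTerm_locallyFinite e)

lemma homotopy_vac : F.homotopy e F.vac = 0 := by
  refine (hasFinsum_locSum (F.homotopyTerm_locallyFinite e) _).unique
    (hasFinsum_zero.congr fun a => ?_)
  rw [homotopyTerm_apply]
  rcases le_or_gt 0 a.2 with h | h
  · have : F.β (modeVec e a) F.vac = 0 := F.β_vac _ h _
    rw [← F.c_β, this, map_zero, smul_zero]
  · have : F.c (modeCovec e a) F.vac = 0 := F.c_vac _ (by omega) _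
    rw [this, map_zero, smul_zero]

lemma homotopy_β (x : Loop K ℓ) (w : M) : F.homotopy e (F.β x w) = F.β x (F.homotopy e w) :=
  locSum_apply_comm _ _ (fun a w => by
    rw [homotopyTerm_apply, homotopyTerm_apply, F.c_β, F.β_β, map_smul]) w

lemma homotopy_c (f : RestrictedDual K ℓ) (w : M) :
    F.homotopy e (F.c f w) = -F.c f (F.homotopy e w) :=
  locSum_apply_anticomm _ _ (fun a w => by
    rw [homotopyTerm_apply, homotopyTerm_apply, F.c_c, map_neg, map_smul, F.c_β, smul_neg]) w

/-- Only summands of the same degree as the generator contract with it, so a single sign comes out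
of the sum. -/
lemma homotopy_b (n : ℤ) (u : ℓ) (w : M) :
    F.homotopy e (F.b (loopMode K n u) w) =
      -F.b (loopMode K n u) (F.homotopy e w) + modeSign K n • F.β (loopMode K n u) w := by
  have h := hasFinsum_bracket (F.homotopyTerm_locallyFinite e) (F.b (loopMode K n u)) (-1 : K)
    (fun a => modeSign K n • pairing K ℓ (modeCovec e a) (loopMode K n u) •
      F.β (modeVec e a) w) w fun a => by
      have hs : modeSign K a.2 • pairing K ℓ (modeCovec e a) (loopMode K n u) •
          F.β (modeVec e a) w = modeSign K n • pairing K ℓ (modeCovec e a) (loopMode K n u) •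
            F.β (modeVec e a) w := by
        by_cases hn : n = a.2
        · rw [hn]
        · rw [modeCovec, pairing_modes, if_neg (by omega), zero_smul, smul_zero, smul_zero]
      rw [homotopyTerm_apply, homotopyTerm_apply, F.c_b, map_add, map_neg, map_smul, ← F.b_β,
        map_smul, smul_add, smul_neg, hs, neg_smul, one_smul]
  have := h.unique ((hasFinsum_apply_modeVec e (F.β.flip w) (loopMode K n u)).smul (modeSign K n))
  rw [neg_smul, one_smul] at this
  exact eq_add_of_sub_eq' this

/-- Here the contraction enters with a minus sign, unlike for $b$. This is why the homotopy weights
non-negative degrees by $-1$: creation operators of both kinds then raise the number by $+1$. -/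
lemma homotopy_γ (n : ℤ) (f : Module.Dual K ℓ) (w : M) :
    F.homotopy e (F.γ (dualMode n f) w) =
      F.γ (dualMode n f) (F.homotopy e w) - modeSign K (-n) • F.c (dualMode n f) w := by
  have h := hasFinsum_bracket (F.homotopyTerm_locallyFinite e) (F.γ (dualMode n f)) (1 : K)
    (fun a => (-modeSign K (-n)) • pairing K ℓ (dualMode n f) (modeVec e a) •
      F.c (modeCovec e a) w) w fun a => by
      have hs : modeSign K a.2 • pairing K ℓ (dualMode n f) (modeVec e a) •
          F.c (modeCovec e a) w = modeSign K (-n) • pairing K ℓ (dualMode n f) (modeVec e a) •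
            F.c (modeCovec e a) w := by
        by_cases hn : a.2 = -n
        · rw [hn]
        · rw [modeVec, pairing_modes, if_neg (by omega), zero_smul, smul_zero, smul_zero]
      rw [homotopyTerm_apply, homotopyTerm_apply, F.c_γ, map_smul, F.γ_β, smul_add, hs, one_smul,
        neg_smul]
      abel
  have := h.unique ((hasFinsum_apply_modeCovec e (F.c.flip w) (dualMode n f)).smul
    (-modeSign K (-n)))
  rw [one_smul, neg_smul] at this
  rw [sub_eq_add_neg]
  exact eq_add_of_sub_eq' this

/-- The number operator, which counts creation operators. -/
noncomputable def number : Module.End K M :=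
  F.koszulOp e * F.homotopy e + F.homotopy e * F.koszulOp e

lemma number_apply (w : M) : F.number e w =
    F.koszulOp e (F.homotopy e w) + F.homotopy e (F.koszulOp e w) := rfl

lemma number_vac : F.number e F.vac = 0 := by
  rw [number_apply, F.homotopy_vac, F.koszulOp_vac, map_zero, map_zero, add_zero]

lemma number_β {n : ℤ} (hn : n ≤ -1) (u : ℓ) (w : M) :
    F.number e (F.β (loopMode K n u) w) =
      F.β (loopMode K n u) (F.number e w) + F.β (loopMode K n u) w := by
  have hs : modeSign K n = 1 := if_pos (by omega)
  simp only [number_apply, F.homotopy_β, F.koszulOp_β, map_add, F.homotopy_b, hs, one_smul]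
  abel

lemma number_b {n : ℤ} (hn : n ≤ -1) (u : ℓ) (w : M) :
    F.number e (F.b (loopMode K n u) w) =
      F.b (loopMode K n u) (F.number e w) + F.b (loopMode K n u) w := by
  have hs : modeSign K n = 1 := if_pos (by omega)
  simp only [number_apply, F.koszulOp_b, F.koszulOp_β, map_add, map_neg, F.homotopy_b, hs,
    one_smul]
  abel

lemma number_γ {n : ℤ} (hn : n ≤ 0) (f : Module.Dual K ℓ) (w : M) :
    F.number e (F.γ (dualMode n f) w) =
      F.γ (dualMode n f) (F.number e w) + F.γ (dualMode n f) w := by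
  have hs : modeSign K (-n) = -1 := if_neg (by omega)
  simp only [number_apply, F.koszulOp_γ, F.koszulOp_c, map_add, map_sub, map_neg, F.homotopy_γ, hs,
    neg_smul, one_smul]
  abel

lemma number_c {n : ℤ} (hn : n ≤ 0) (f : Module.Dual K ℓ) (w : M) :
    F.number e (F.c (dualMode n f) w) =
      F.c (dualMode n f) (F.number e w) + F.c (dualMode n f) w := by
  have hs : modeSign K (-n) = -1 := if_neg (by omega)
  simp only [number_apply, F.koszulOp_c, F.homotopy_c, map_add, map_neg, F.homotopy_γ, hs,
    neg_smul, one_smul]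
  abel

/-- The products of `r` creation operators, applied to the vacuum. -/
inductive IsMonomial : ℕ → M → Prop
  | vac : IsMonomial 0 F.vac
  | b {n : ℤ} (hn : n ≤ -1) (u : ℓ) {r : ℕ} {w : M} :
      IsMonomial r w → IsMonomial (r + 1) (F.b (loopMode K n u) w)
  | c {n : ℤ} (hn : n ≤ 0) (f : Module.Dual K ℓ) {r : ℕ} {w : M} :
      IsMonomial r w → IsMonomial (r + 1) (F.c (dualMode n f) w)
  | β {n : ℤ} (hn : n ≤ -1) (u : ℓ) {r : ℕ} {w : M} :
      IsMonomial r w → IsMonomial (r + 1) (F.β (loopMode K n u) w)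
  | γ {n : ℤ} (hn : n ≤ 0) (f : Module.Dual K ℓ) {r : ℕ} {w : M} :
      IsMonomial r w → IsMonomial (r + 1) (F.γ (dualMode n f) w)

lemma number_of_isMonomial {r : ℕ} {w : M} (hw : F.IsMonomial r w) :
    F.number e w = (r : K) • w := by
  induction hw with
  | vac => rw [F.number_vac, Nat.cast_zero, zero_smul]
  | b hn u _ ih => rw [F.number_b e hn, ih, map_smul, Nat.cast_succ, add_smul, one_smul]
  | c hn u _ ih => rw [F.number_c e hn, ih, map_smul, Nat.cast_succ, add_smul, one_smul]
  | β hn u _ ih => rw [F.number_β e hn, ih, map_smul, Nat.cast_succ, add_smul, one_smul]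
  | γ hn u _ ih => rw [F.number_γ e hn, ih, map_smul, Nat.cast_succ, add_smul, one_smul]

/-- An annihilation operator moves through a monomial until it reaches the vacuum, and each
contraction leaves a shorter monomial. So the span is stable under all generators and cyclicity
applies. -/
lemma span_isMonomial : Submodule.span K {w | ∃ r, F.IsMonomial r w} = ⊤ := by
  set P := Submodule.span K {w | ∃ r, F.IsMonomial r w} with hP
  have hmem : ∀ {r w}, F.IsMonomial r w → w ∈ P := fun h => Submodule.subset_span ⟨_, h⟩
  have hstab : ∀ A : Module.End K M, (∀ r w, F.IsMonomial r w → A w ∈ P) → ∀ w ∈ P, A w ∈ P := by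
    intro A hA w hw
    have : P ≤ P.comap A := Submodule.span_le.2 fun w ⟨r, hr⟩ => hA r w hr
    exact this hw
  have cb : ∀ {n : ℤ}, n ≤ -1 → ∀ (u : ℓ), ∀ w ∈ P, F.b (loopMode K n u) w ∈ P :=
    fun hn u => hstab _ fun _ _ h => hmem (.b hn u h)
  have cc : ∀ {n : ℤ}, n ≤ 0 → ∀ f : Module.Dual K ℓ, ∀ w ∈ P, F.c (dualMode n f) w ∈ P :=
    fun hn u => hstab _ fun _ _ h => hmem (.c hn u h)
  have cβ : ∀ {n : ℤ}, n ≤ -1 → ∀ (u : ℓ), ∀ w ∈ P, F.β (loopMode K n u) w ∈ P :=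
    fun hn u => hstab _ fun _ _ h => hmem (.β hn u h)
  have cγ : ∀ {n : ℤ}, n ≤ 0 → ∀ f : Module.Dual K ℓ, ∀ w ∈ P, F.γ (dualMode n f) w ∈ P :=
    fun hn u => hstab _ fun _ _ h => hmem (.γ hn u h)
  refine F.eq_top_of_stable P (hmem .vac) ?_ ?_ ?_ ?_
  · intro n u
    rcases le_or_gt n (-1) with hn | hn
    · exact cb hn u
    refine hstab _ fun r w h => ?_
    induction h with
    | vac => rw [F.b_vac n (by omega)]; exact zero_mem P
    | b hn u h ih => rw [F.b_b]; exact neg_mem (cb hn _ _ ih)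
    | c hn u h ih =>
      rw [F.b_c]
      exact add_mem (neg_mem (cc hn _ _ ih)) (P.smul_mem _ (hmem h))
    | β hn u h ih => rw [F.b_β]; exact cβ hn _ _ ih
    | γ hn u h ih => rw [F.b_γ]; exact cγ hn _ _ ih
  · intro n f
    rcases le_or_gt n 0 with hn | hn
    · exact cc hn f
    refine hstab _ fun r w h => ?_
    induction h with
    | vac => rw [F.c_vac n (by omega)]; exact zero_mem P
    | b hn u h ih =>
      rw [F.c_b]
      exact add_mem (neg_mem (cb hn _ _ ih)) (P.smul_mem _ (hmem h))
    | c hn u h ih => rw [F.c_c]; exact neg_mem (cc hn _ _ ih)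
    | β hn u h ih => rw [F.c_β]; exact cβ hn _ _ ih
    | γ hn u h ih => rw [F.c_γ]; exact cγ hn _ _ ih
  · intro n u
    rcases le_or_gt n (-1) with hn | hn
    · exact cβ hn u
    refine hstab _ fun r w h => ?_
    induction h with
    | vac => rw [F.β_vac n (by omega)]; exact zero_mem P
    | b hn u h ih => rw [← F.b_β]; exact cb hn _ _ ih
    | c hn u h ih => rw [← F.c_β]; exact cc hn _ _ ih
    | β hn u h ih => rw [F.β_β]; exact cβ hn _ _ ih
    | γ hn u h ih =>
      rw [← sub_eq_of_eq_add (F.γ_β _ _ _)]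
      exact sub_mem (cγ hn _ _ ih) (P.smul_mem _ (hmem h))
  · intro n f
    rcases le_or_gt n 0 with hn | hn
    · exact cγ hn f
    refine hstab _ fun r w h => ?_
    induction h with
    | vac => rw [F.γ_vac n (by omega)]; exact zero_mem P
    | b hn u h ih => rw [← F.b_γ]; exact cb hn _ _ ih
    | c hn u h ih => rw [← F.c_γ]; exact cc hn _ _ ih
    | β hn u h ih =>
      rw [F.γ_β]
      exact add_mem (cβ hn _ _ ih) (P.smul_mem _ (hmem h))
    | γ hn u h ih => rw [F.γ_γ]; exact cγ hn _ _ ih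

/-! ### The total differential, its normally ordered form, and its homology -/

/-- The total differential `h + [h, T]`. -/
noncomputable def total : Module.End K M :=
  F.koszulOp e * F.twist e - F.twist e * F.koszulOp e + F.koszulOp e

lemma total_vac : F.total e F.vac = 0 := by
  simp [total, F.twist_vac, F.koszulOp_vac]

/-- The operators `:β^{[u,v]} γ^{v'} c^{u'}:`. -/
noncomputable def symOrdered (p : (ι × ℤ) × (ι × ℤ)) : Module.End K M :=
  if p.1.2 + p.2.2 ≤ -1 then
    F.β ⁅modeVec e p.1, modeVec e p.2⁆ * (F.γ (modeCovec e p.2) * F.c (modeCovec e p.1))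
  else F.γ (modeCovec e p.2) * F.c (modeCovec e p.1) * F.β ⁅modeVec e p.1, modeVec e p.2⁆

/-- The operators `:b^{[u,v]} c^{v'} c^{u'}:`. -/
noncomputable def extOrdered (p : (ι × ℤ) × (ι × ℤ)) : Module.End K M :=
  if p.1.2 + p.2.2 ≤ -1 then
    F.b ⁅modeVec e p.1, modeVec e p.2⁆ * (F.c (modeCovec e p.2) * F.c (modeCovec e p.1))
  else F.c (modeCovec e p.2) * F.c (modeCovec e p.1) * F.b ⁅modeVec e p.1, modeVec e p.2⁆

/-- Applying $h$ to $\beta$ gives the $bcc$ term, and applying it to either $c$ gives the two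
$\beta\gamma c$ terms. When $[u,v]$ has non-negative degree, its $b$ or $\beta$ is moved to the
right. The contractions $\langle v',[u,v]\rangle c^{u'}$ and $\langle u',[u,v]\rangle c^{v'}$ from
the $bc$ side cancel those from the $\beta\gamma$ side. -/
lemma koszulOp_twistTerm (p : (ι × ℤ) × (ι × ℤ)) (w : M) :
    F.koszulOp e (F.twistTerm e p w) - F.twistTerm e p (F.koszulOp e w) =
      F.extOrdered e p w + F.symOrdered e p w + F.symOrdered e p.swap w := by
  have hs : ⁅modeVec e p.2, modeVec e p.1⁆ = -⁅modeVec e p.1, modeVec e p.2⁆ :=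
    (lie_skew _ _).symm
  simp only [twistTerm_apply, extOrdered, symOrdered, Prod.fst_swap, Prod.snd_swap, hs,
    add_comm p.2.2 p.1.2]
  split_ifs with h
  · simp only [Module.End.mul_apply, F.koszulOp_β, F.koszulOp_c, map_add, map_neg,
      LinearMap.neg_apply, F.c_γ]
    abel
  · simp only [Module.End.mul_apply, F.koszulOp_β, F.koszulOp_c, map_add, map_neg,
      LinearMap.neg_apply, F.c_γ, F.b_c, F.γ_β, F.c_β, map_smul]
    abel

/-- The total differential is the sum of the normally ordered cubic operator and the Koszul
differential. -/
lemma total_eq [CharZero K] {S E : Module.End K M}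
    (hS : ∀ w, HasFinsum (fun p => F.symOrdered e p w) (S w))
    (hE : ∀ w, HasFinsum (fun p => F.extOrdered e p w) (E w)) :
    F.total e = S + (1 / 2 : K) • E + F.koszulOp e := by
  refine LinearMap.ext fun w => ?_
  have h1 := (hasFinsum_locSum (F.twistTerm_locallyFinite e) w).map (F.koszulOp e)
  have h2 := h1.sub (hasFinsum_locSum (F.twistTerm_locallyFinite e) (F.koszulOp e w))
  have h3 := h2.unique ((((hE w).add (hS w)).add ((hS w).equiv (Equiv.prodComm _ _))).congr
    fun p => F.koszulOp_twistTerm e p w)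
  have h4 : F.koszulOp e (F.twist e w) - F.twist e (F.koszulOp e w) = S w + (1 / 2 : K) • E w := by
    rw [twist, LinearMap.smul_apply, LinearMap.smul_apply, map_smul, ← smul_sub, h3, add_assoc,
      ← two_smul K, smul_add, smul_smul, add_comm]
    norm_num
  simp only [total, LinearMap.add_apply, LinearMap.sub_apply, Module.End.mul_apply,
    LinearMap.smul_apply, h4]

variable [CharZero K]

open Polynomial in
-- Every vector is a finite combination of eigenvectors, so a product of factors $X-r$ with $r>0$
-- removes all but the vacuum component. Characteristic zero keeps the value at $0$ non-zero.
lemma exists_aeval_number (w : M) :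
    ∃ p : K[X], p.eval 0 ≠ 0 ∧ ∃ r : K, aeval (F.number e) p w = r • F.vac := by
  have hvac : ∀ p : K[X], aeval (F.number e) p F.vac = p.eval 0 • F.vac := fun p => by
    conv_lhs => rw [← p.divX_mul_X_add]
    simp [F.number_vac, coeff_zero_eq_eval_zero, Algebra.algebraMap_eq_smul_one]
  have hw : w ∈ Submodule.span K {w | ∃ r, F.IsMonomial r w} := by
    rw [F.span_isMonomial]; exact Submodule.mem_top
  induction hw using Submodule.span_induction with
  | mem w h =>
    obtain ⟨r, hr⟩ := h
    rcases Nat.eq_zero_or_pos r with rfl | h0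
    · cases hr
      exact ⟨1, by simp, 1, by simp⟩
    · refine ⟨X - C (r : K), by simpa using h0.ne', 0, ?_⟩
      rw [map_sub, aeval_X, aeval_C, LinearMap.sub_apply, F.number_of_isMonomial e hr,
        Module.algebraMap_end_apply, sub_self, zero_smul]
  | zero => exact ⟨1, by simp, 0, by simp⟩
  | add x y _ _ hx hy =>
    obtain ⟨p, hp, r, hr⟩ := hx
    obtain ⟨q, hq, s, hs⟩ := hy
    refine ⟨p * q, by simp [hp, hq], q.eval 0 * r + p.eval 0 * s, ?_⟩
    rw [map_add, map_mul, Module.End.mul_apply, Module.End.mul_apply, hs, map_smul, hvac,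
      ← Module.End.mul_apply, ← map_mul, mul_comm p q, map_mul, Module.End.mul_apply, hr, map_smul,
      hvac, add_smul, smul_smul, smul_smul, mul_comm r, mul_comm s]
  | smul a x _ hx =>
    obtain ⟨p, hp, r, hr⟩ := hx
    exact ⟨p, hp, a * r, by rw [map_smul, hr, smul_smul]⟩

/-- The vanishing double bracket says that $[h,T]$ commutes with $T$, so the expansion of
$e^{-T}he^T$ stops after the linear term. -/
lemma koszulOp_localExp (w : M) :
    F.koszulOp e (localExp (F.twist_locallyNilpotent e) w) =
      localExp (F.twist_locallyNilpotent e) (F.total e w) := by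
  refine apply_localExp _ _ (LinearMap.ext fun w => ?_) w
  have h := F.koszulOp_twist_twist e w
  rw [two_smul, sub_add_eq_add_sub, sub_eq_zero] at h
  simp only [Module.End.mul_apply, LinearMap.sub_apply, map_sub]
  rw [sub_eq_sub_iff_add_eq_add, ← h, add_comm]

lemma total_total (w : M) : F.total e (F.total e w) = 0 := by
  refine localExp_injective (F.twist_locallyNilpotent e) ?_
  rw [← F.koszulOp_localExp, ← F.koszulOp_localExp, F.koszulOp_koszulOp, map_zero]

lemma homology_total : (∀ x, F.total e x = 0 → ∃ (z : M) (r : K), x = F.total e z + r • F.vac) ∧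
    (F.vac ≠ 0 → ∀ z, F.total e z ≠ F.vac) := by
  obtain ⟨h1, h2⟩ := homology_of_homotopy (F.koszulOp_koszulOp e) (F.koszulOp_vac e)
    (F.homotopy_vac e) (F.exists_aeval_number e)
  have hT := F.twist_locallyNilpotent e
  have hE : localExp hT F.vac = F.vac := localExp_apply_of_eq_zero hT (F.twist_vac e)
  constructor
  · intro x hx
    obtain ⟨z, r, hz⟩ := h1 (localExp hT x) (by rw [F.koszulOp_localExp, hx, map_zero])
    obtain ⟨z, rfl⟩ := localExp_surjective hT z
    refine ⟨z, r, localExp_injective hT ?_⟩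
    rw [hz, F.koszulOp_localExp, map_add, map_smul, hE]
  · intro h0 z hz
    exact h2 h0 (localExp hT z) (by rw [F.koszulOp_localExp, hz, hE])

end ModeRep

/-! ### The semi-infinite Weil complex as a module over the mode operators -/

section Modes

variable {K : Type*} [Field K] {ℓ : Type*} [LieRing ℓ] [LieAlgebra K ℓ]

lemma cliffOp_add (v w : Double K ℓ) : cliffOp K ℓ (v + w) = cliffOp K ℓ v + cliffOp K ℓ w := by
  simp only [cliffOp, map_add, LinearMap.lTensor_add]

lemma cliffOp_smul (r : K) (v : Double K ℓ) : cliffOp K ℓ (r • v) = r • cliffOp K ℓ v := by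
  simp only [cliffOp, map_smul, LinearMap.lTensor_smul]

lemma weylOp_add (v w : Double K ℓ) : weylOp K ℓ (v + w) = weylOp K ℓ v + weylOp K ℓ w := by
  simp only [weylOp, map_add, LinearMap.rTensor_add]

lemma weylOp_smul (r : K) (v : Double K ℓ) : weylOp K ℓ (r • v) = r • weylOp K ℓ v := by
  simp only [weylOp, map_smul, LinearMap.rTensor_smul]

variable (K ℓ) in
/-- The operators `b`, as a linear function on the loop algebra. -/
noncomputable def bOp : Loop K ℓ →ₗ[K] Module.End K (SemiInfWeil K ℓ) where
  toFun x := cliffOp K ℓ (x, 0)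
  map_add' x y := by rw [← cliffOp_add, Prod.mk_add_mk, add_zero]
  map_smul' r x := by rw [RingHom.id_apply, ← cliffOp_smul, Prod.smul_mk, smul_zero]

variable (K ℓ) in
/-- The operators `c`, as a linear function on the restricted dual. -/
noncomputable def cOp : RestrictedDual K ℓ →ₗ[K] Module.End K (SemiInfWeil K ℓ) where
  toFun f := cliffOp K ℓ (0, f)
  map_add' x y := by rw [← cliffOp_add, Prod.mk_add_mk, add_zero]
  map_smul' r x := by rw [RingHom.id_apply, ← cliffOp_smul, Prod.smul_mk, smul_zero]

variable (K ℓ) in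
/-- The operators `β`, as a linear function on the loop algebra. -/
noncomputable def βOp : Loop K ℓ →ₗ[K] Module.End K (SemiInfWeil K ℓ) where
  toFun x := weylOp K ℓ (x, 0)
  map_add' x y := by rw [← weylOp_add, Prod.mk_add_mk, add_zero]
  map_smul' r x := by rw [RingHom.id_apply, ← weylOp_smul, Prod.smul_mk, smul_zero]

variable (K ℓ) in
/-- The operators `γ`, as a linear function on the restricted dual. -/
noncomputable def γOp : RestrictedDual K ℓ →ₗ[K] Module.End K (SemiInfWeil K ℓ) where
  toFun f := weylOp K ℓ (0, f)
  map_add' x y := by rw [← weylOp_add, Prod.mk_add_mk, add_zero]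
  map_smul' r x := by rw [RingHom.id_apply, ← weylOp_smul, Prod.smul_mk, smul_zero]

lemma bOp_apply (x : Loop K ℓ) : bOp K ℓ x = cliffOp K ℓ (x, 0) := rfl

lemma cOp_apply (f : RestrictedDual K ℓ) : cOp K ℓ f = cliffOp K ℓ (0, f) := rfl

lemma βOp_apply (x : Loop K ℓ) : βOp K ℓ x = weylOp K ℓ (x, 0) := rfl

lemma γOp_apply (f : RestrictedDual K ℓ) : γOp K ℓ f = weylOp K ℓ (0, f) := rfl

lemma weylOp_weylOp (v w : Double K ℓ) (x : SemiInfWeil K ℓ) :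
    weylOp K ℓ v (weylOp K ℓ w x) =
      weylOp K ℓ w (weylOp K ℓ v x) + symplecticForm K ℓ v w • x := by
  have h := WeylAlgebra.ι_mul_ι (symplecticForm K ℓ) v w
  rw [← Module.End.mul_apply, ← Module.End.mul_apply]
  simp only [weylOp, ← LinearMap.rTensor_mul, ← map_mul, h, map_add, LinearMap.rTensor_add,
    LinearMap.add_apply, Algebra.algebraMap_eq_smul_one, map_smul, map_one,
    LinearMap.rTensor_smul, LinearMap.smul_apply]
  congr 2
  exact LinearMap.congr_fun (LinearMap.rTensor_id _ _) x

lemma cliffOp_cliffOp (v w : Double K ℓ) (x : SemiInfWeil K ℓ) :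
    cliffOp K ℓ v (cliffOp K ℓ w x) = - cliffOp K ℓ w (cliffOp K ℓ v x) +
      (pairing K ℓ v.2 w.1 + pairing K ℓ w.2 v.1) • x := by
  have h := CliffordAlgebra.ι_mul_ι_comm (Q := quadForm K ℓ) v w
  rw [polar_quadForm] at h
  rw [← Module.End.mul_apply, ← Module.End.mul_apply]
  simp only [cliffOp, ← LinearMap.lTensor_mul, ← map_mul, h, map_sub, LinearMap.lTensor_sub,
    LinearMap.sub_apply, Algebra.algebraMap_eq_smul_one, map_smul, map_one,
    LinearMap.lTensor_smul, LinearMap.smul_apply]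
  rw [sub_eq_neg_add]
  congr 2
  exact LinearMap.congr_fun (LinearMap.lTensor_id _ _) x

section Relations

variable (x y : Loop K ℓ) (f g : RestrictedDual K ℓ) (w : SemiInfWeil K ℓ)

lemma γOp_βOp : γOp K ℓ f (βOp K ℓ x w) = βOp K ℓ x (γOp K ℓ f w) + pairing K ℓ f x • w := by
  simpa [bOp_apply, cOp_apply, βOp_apply, γOp_apply, symplecticForm] using weylOp_weylOp (0, f) (x, 0) w

lemma βOp_βOp : βOp K ℓ x (βOp K ℓ y w) = βOp K ℓ y (βOp K ℓ x w) := by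
  simpa [bOp_apply, cOp_apply, βOp_apply, γOp_apply, symplecticForm] using weylOp_weylOp (x, 0) (y, 0) w

lemma γOp_γOp : γOp K ℓ f (γOp K ℓ g w) = γOp K ℓ g (γOp K ℓ f w) := by
  simpa [bOp_apply, cOp_apply, βOp_apply, γOp_apply, symplecticForm] using weylOp_weylOp (0, f) (0, g) w

lemma cOp_bOp : cOp K ℓ f (bOp K ℓ x w) = - bOp K ℓ x (cOp K ℓ f w) + pairing K ℓ f x • w := by
  simpa [bOp_apply, cOp_apply, βOp_apply, γOp_apply] using cliffOp_cliffOp (0, f) (x, 0) w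

lemma bOp_bOp : bOp K ℓ x (bOp K ℓ y w) = - bOp K ℓ y (bOp K ℓ x w) := by
  simpa [bOp_apply, cOp_apply, βOp_apply, γOp_apply] using cliffOp_cliffOp (x, 0) (y, 0) w

lemma cOp_cOp : cOp K ℓ f (cOp K ℓ g w) = - cOp K ℓ g (cOp K ℓ f w) := by
  simpa [bOp_apply, cOp_apply, βOp_apply, γOp_apply] using cliffOp_cliffOp (0, f) (0, g) w

lemma bOp_βOp : bOp K ℓ x (βOp K ℓ y w) = βOp K ℓ y (bOp K ℓ x w) :=
  (weylOp_cliffOp _ _ w).symm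

lemma cOp_βOp : cOp K ℓ f (βOp K ℓ y w) = βOp K ℓ y (cOp K ℓ f w) :=
  (weylOp_cliffOp _ _ w).symm

lemma bOp_γOp : bOp K ℓ x (γOp K ℓ f w) = γOp K ℓ f (bOp K ℓ x w) :=
  (weylOp_cliffOp _ _ w).symm

lemma cOp_γOp : cOp K ℓ f (γOp K ℓ g w) = γOp K ℓ g (cOp K ℓ f w) :=
  (weylOp_cliffOp _ _ w).symm

end Relations

/-- A subspace that contains the vacuum and is stable under all generators is everything. -/
lemma eq_top_of_stable {P : Submodule K (SemiInfWeil K ℓ)} (h1 : vacuum K ℓ ∈ P)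
    (hP : ∀ g : Gen K ℓ, ∀ w ∈ P, g.op w ∈ P) : P = ⊤ := by
  have hβ : ∀ x, ∀ w ∈ P, βOp K ℓ x w ∈ P := fun x w hw => by
    induction x using loop_induction with
    | h0 => simp
    | hadd x y hx hy => rw [map_add]; exact add_mem hx hy
    | hmode n u => exact hP (.β n u) w hw
  have hb : ∀ x, ∀ w ∈ P, bOp K ℓ x w ∈ P := fun x w hw => by
    induction x using loop_induction with
    | h0 => simp
    | hadd x y hx hy => rw [map_add]; exact add_mem hx hy
    | hmode n u => exact hP (.b n u) w hw
  have hγ : ∀ f, ∀ w ∈ P, γOp K ℓ f w ∈ P := fun f w hw => by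
    induction f using restrictedDual_induction with
    | h0 => simp
    | hadd x y hx hy => rw [map_add]; exact add_mem hx hy
    | hmode n u => exact hP (.γ n u) w hw
  have hc : ∀ f, ∀ w ∈ P, cOp K ℓ f w ∈ P := fun f w hw => by
    induction f using restrictedDual_induction with
    | h0 => simp
    | hadd x y hx hy => rw [map_add]; exact add_mem hx hy
    | hmode n u => exact hP (.c n u) w hw
  have hweyl : ∀ a : Weyl K ℓ, ∀ w ∈ P,
      LinearMap.rTensor (SemiInfExt K ℓ) (Algebra.lsmul K K (SemiInfSym K ℓ) a) w ∈ P := by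
    intro a
    induction a using WeylAlgebra.induction with
    | hK r =>
      intro w hw
      have : LinearMap.rTensor (SemiInfExt K ℓ) (Algebra.lsmul K K (SemiInfSym K ℓ)
          (algebraMap K (Weyl K ℓ) r)) = r • LinearMap.id := by
        rw [Algebra.algebraMap_eq_smul_one, map_smul, map_one, LinearMap.rTensor_smul]
        congr 1
        exact LinearMap.rTensor_id _ _
      rw [this]
      exact P.smul_mem r hw
    | hι v =>
      intro w hw
      have := add_mem (hβ v.1 w hw) (hγ v.2 w hw)
      rw [← LinearMap.add_apply] at this
      change (weylOp K ℓ (v.1, 0) + weylOp K ℓ (0, v.2)) w ∈ P at this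
      rw [← weylOp_add, Prod.mk_add_mk, add_zero, zero_add] at this
      exact this
    | hmul a b ha hb =>
      intro w hw
      rw [map_mul, LinearMap.rTensor_mul]
      exact ha _ (hb _ hw)
    | hadd a b ha hb =>
      intro w hw
      rw [map_add, LinearMap.rTensor_add]
      exact add_mem (ha _ hw) (hb _ hw)
  have hcliff : ∀ a : Cliff K ℓ, ∀ w ∈ P,
      LinearMap.lTensor (SemiInfSym K ℓ) (Algebra.lsmul K K (SemiInfExt K ℓ) a) w ∈ P := by
    intro a
    induction a using CliffordAlgebra.induction with
    | algebraMap r =>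
      intro w hw
      have : LinearMap.lTensor (SemiInfSym K ℓ) (Algebra.lsmul K K (SemiInfExt K ℓ)
          (algebraMap K (Cliff K ℓ) r)) = r • LinearMap.id := by
        rw [Algebra.algebraMap_eq_smul_one, map_smul, map_one, LinearMap.lTensor_smul]
        congr 1
        exact LinearMap.lTensor_id _ _
      rw [this]
      exact P.smul_mem r hw
    | ι v =>
      intro w hw
      have := add_mem (hb v.1 w hw) (hc v.2 w hw)
      rw [← LinearMap.add_apply] at this
      change (cliffOp K ℓ (v.1, 0) + cliffOp K ℓ (0, v.2)) w ∈ P at this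
      rw [← cliffOp_add, Prod.mk_add_mk, add_zero, zero_add] at this
      exact this
    | mul a b ha hb =>
      intro w hw
      rw [map_mul, LinearMap.lTensor_mul]
      exact ha _ (hb _ hw)
    | add a b ha hb =>
      intro w hw
      rw [map_add, LinearMap.lTensor_add]
      exact add_mem (ha _ hw) (hb _ hw)
  rw [eq_top_iff]
  rintro w -
  induction w using TensorProduct.induction_on with
  | zero => exact zero_mem _
  | add x y hx hy => exact add_mem hx hy
  | tmul s e =>
    obtain ⟨a, rfl⟩ := (symIdeal K ℓ).mkQ_surjective s
    obtain ⟨d, rfl⟩ := (extIdeal K ℓ).mkQ_surjective e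
    have h := hcliff d _ (hweyl a _ h1)
    have ha : (symIdeal K ℓ).mkQ a = Algebra.lsmul K K (SemiInfSym K ℓ) a
        ((symIdeal K ℓ).mkQ 1) := by
      rw [Algebra.lsmul_coe]
      beta_reduce
      rw [← map_smul, smul_eq_mul, mul_one]
    have hd : (extIdeal K ℓ).mkQ d = Algebra.lsmul K K (SemiInfExt K ℓ) d
        ((extIdeal K ℓ).mkQ 1) := by
      rw [Algebra.lsmul_coe]
      beta_reduce
      rw [← map_smul, smul_eq_mul, mul_one]
    rw [ha, hd]
    exact h

lemma Gen.op_vacuum {g : Gen K ℓ} (hg : ¬ g.IsCreation) : g.op (vacuum K ℓ) = 0 := by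
  have hs : ∀ v ∈ annihilationVectors K ℓ, weylOp K ℓ v (vacuum K ℓ) = 0 := fun v hv => by
    rw [vacuum, weylOp, LinearMap.rTensor_tmul, Algebra.lsmul_coe]
    beta_reduce
    have h : WeylAlgebra.ι (symplecticForm K ℓ) v ∈ symIdeal K ℓ :=
      Submodule.subset_span (Set.mem_image_of_mem _ hv)
    rw [← map_smul, smul_eq_mul, mul_one, (symIdeal K ℓ).mkQ_apply,
      (Submodule.Quotient.mk_eq_zero _).2 h, TensorProduct.zero_tmul]
  have he : ∀ v ∈ annihilationVectors K ℓ, cliffOp K ℓ v (vacuum K ℓ) = 0 := fun v hv => by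
    rw [vacuum, cliffOp, LinearMap.lTensor_tmul, Algebra.lsmul_coe]
    beta_reduce
    have h : CliffordAlgebra.ι (quadForm K ℓ) v ∈ extIdeal K ℓ :=
      Submodule.subset_span (Set.mem_image_of_mem _ hv)
    rw [← map_smul, smul_eq_mul, mul_one, (extIdeal K ℓ).mkQ_apply,
      (Submodule.Quotient.mk_eq_zero _).2 h, TensorProduct.tmul_zero]
  cases g with
  | b n u => exact he _ (Or.inl ⟨n, by simp only [IsCreation] at hg; omega, u, rfl⟩)
  | c n u => exact he _ (Or.inr ⟨n, by simp only [IsCreation] at hg; omega, u, rfl⟩)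
  | β n u => exact hs _ (Or.inl ⟨n, by simp only [IsCreation] at hg; omega, u, rfl⟩)
  | γ n u => exact hs _ (Or.inr ⟨n, by simp only [IsCreation] at hg; omega, u, rfl⟩)

variable (K ℓ) in
/-- The semi-infinite Weil complex with its mode operators. -/
noncomputable def weilRep : ModeRep K ℓ (SemiInfWeil K ℓ) where
  b := bOp K ℓ
  c := cOp K ℓ
  β := βOp K ℓ
  γ := γOp K ℓ
  γ_β f x w := γOp_βOp x f w
  β_β := βOp_βOp
  γ_γ := γOp_γOp
  c_b f x w := cOp_bOp x f w
  b_b := bOp_bOp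
  c_c := cOp_cOp
  b_β := bOp_βOp
  c_β f x w := cOp_βOp x f w
  b_γ := bOp_γOp
  c_γ := cOp_γOp
  exists_bound w := by
    obtain ⟨N, -, hN⟩ := VOWA.exists_bound w
    exact ⟨N, fun n hn => ⟨fun u => ⟨hN (.b n u) hn, hN (.β n u) hn⟩,
      fun f => ⟨hN (.c n f) hn, hN (.γ n f) hn⟩⟩⟩
  vac := vacuum K ℓ
  b_vac n hn u := Gen.op_vacuum (g := .b n u) (by simp only [Gen.IsCreation]; omega)
  β_vac n hn u := Gen.op_vacuum (g := .β n u) (by simp only [Gen.IsCreation]; omega)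
  c_vac n hn f := Gen.op_vacuum (g := .c n f) (by simp only [Gen.IsCreation]; omega)
  γ_vac n hn f := Gen.op_vacuum (g := .γ n f) (by simp only [Gen.IsCreation]; omega)
  eq_top_of_stable P h1 hb hc hβ hγ := VOWA.eq_top_of_stable h1 fun g => by
    cases g with
    | b n u => exact hb n u
    | c n f => exact hc n f
    | β n u => exact hβ n u
    | γ n f => exact hγ n f

lemma normalOrder_singleton (g : Gen K ℓ) : normalOrder [g] = g.op := by
  simp only [normalOrder, List.map_nil, List.sum_nil, mul_zero, pow_zero, one_smul, one_mul,
    mul_one, ite_self]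

lemma normalOrder_γ_b (n m : ℤ) (f : Module.Dual K ℓ) (u : ℓ) :
    normalOrder [.γ n f, .b m u] = γOp K ℓ (dualMode n f) * bOp K ℓ (loopMode K m u) := by
  rw [normalOrder, normalOrder_singleton]
  simp only [Gen.parity, zero_mul, pow_zero, one_smul]
  split_ifs
  · rfl
  · exact LinearMap.ext fun w => bOp_γOp _ _ _

lemma normalOrder_γ_c (n m : ℤ) (f g : Module.Dual K ℓ) :
    normalOrder [.γ n f, .c m g] = γOp K ℓ (dualMode n f) * cOp K ℓ (dualMode m g) := by
  rw [normalOrder, normalOrder_singleton]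
  simp only [Gen.parity, zero_mul, pow_zero, one_smul]
  split_ifs
  · rfl
  · exact LinearMap.ext fun w => cOp_γOp _ _ _

lemma normalOrder_c_c (n m : ℤ) (f g : Module.Dual K ℓ) :
    normalOrder [.c n f, .c m g] = cOp K ℓ (dualMode n f) * cOp K ℓ (dualMode m g) := by
  rw [normalOrder, normalOrder_singleton]
  simp only [Gen.parity, List.map_cons, List.map_nil, List.sum_cons, List.sum_nil, add_zero,
    mul_one, pow_one]
  split_ifs
  · rfl
  · refine LinearMap.ext fun w => ?_
    rw [LinearMap.smul_apply, neg_one_smul]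
    exact (cOp_cOp _ _ _).symm

variable {ι : Type*} (e : Module.Basis ι K ℓ)

/-- The factors $\gamma_{-i}^{v'}$ and $c_{-j}^{u'}$ give $v$ degree $i$ and $u$ degree $j$, so the
degrees are paired crosswise with the basis elements. Only the position of $\beta$ depends on normal
ordering, since $\gamma$ and $c$ commute. -/
lemma symTerm_eq (p : (ι × ι) × (ℤ × ℤ)) :
    symTerm e p = (weilRep K ℓ).symOrdered e ((p.1.1, p.2.2), (p.1.2, p.2.1)) := by
  rw [symTerm, normalOrder, normalOrder_γ_c, ModeRep.symOrdered, lie_modeVec]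
  simp only [Gen.parity, zero_mul, pow_zero, one_smul, Gen.IsCreation, add_comm p.2.2]
  rfl

lemma extTerm_eq (p : (ι × ι) × (ℤ × ℤ)) :
    extTerm e p = (weilRep K ℓ).extOrdered e ((p.1.1, p.2.2), (p.1.2, p.2.1)) := by
  rw [extTerm, normalOrder, normalOrder_c_c, ModeRep.extOrdered, lie_modeVec]
  -- Moving $b$ past two odd generators costs no sign.
  have : (-1 : K) ^ (1 * (1 + 1)) = 1 := by norm_num
  simp only [Gen.parity, List.map_cons, List.map_nil, List.sum_cons, List.sum_nil, add_zero,
    this, one_smul, Gen.IsCreation, add_comm p.2.2]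
  rfl

variable [Finite ι]

lemma koszul_eq : koszul e = (weilRep K ℓ).koszulOp e :=
  LinearMap.ext fun w => finsum_congr fun a =>
    LinearMap.congr_fun (normalOrder_γ_b (-a.2) a.2 (e.coord a.1) (e a.1)) w

/-- The reindexing of pairs of modes by the pair of basis elements and the pair of degrees. -/
def modePairEquiv (ι : Type*) : (ι × ℤ) × (ι × ℤ) ≃ (ι × ι) × (ℤ × ℤ) where
  toFun p := ((p.1.1, p.2.1), (p.2.2, p.1.2))
  invFun p := ((p.1.1, p.2.2), (p.1.2, p.2.1))
  left_inv _ := rfl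
  right_inv _ := rfl

lemma Q_add_koszul_eq [CharZero K] : Q e + koszul e = (weilRep K ℓ).total e := by
  rw [(weilRep K ℓ).total_eq e (S := locSum (symTerm e) (symTerm_locallyFinite e))
    (E := locSum (extTerm e) (extTerm_locallyFinite e)) (fun w => ?_) (fun w => ?_),
    koszul_eq]
  · rfl
  · exact ((hasFinsum_locSum (symTerm_locallyFinite e) w).equiv (modePairEquiv ι)).congr fun p =>
      LinearMap.congr_fun (symTerm_eq e (modePairEquiv ι p)).symm w
  · exact ((hasFinsum_locSum (extTerm_locallyFinite e) w).equiv (modePairEquiv ι)).congr fun p =>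
      LinearMap.congr_fun (extTerm_eq e (modePairEquiv ι p)).symm w

end Modes
/-! ### The vacuum is not zero -/

section Polarization

variable {K V : Type*} [Field K] [AddCommGroup V] [Module K V]

open MvPolynomial in
/-- If `ω` vanishes on the image and on the kernel of a projection `P`, then the kernel of `P`
generates a proper left ideal of the Weyl algebra: it annihilates `1` in the polynomial
representation. -/
lemma one_notMem_weylIdeal (ω : V →ₗ[K] V →ₗ[K] K) (P : V →ₗ[K] V)
    (h1 : ∀ v w, ω (P v) (P w) = 0) (h2 : ∀ v w, ω (v - P v) (w - P w) = 0)
    (hskew : ∀ v w, ω v w = -ω w v) {s : Set V} (hs : ∀ v ∈ s, P v = 0) :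
    (1 : WeylAlgebra ω) ∉ Submodule.span (WeylAlgebra ω) (WeylAlgebra.ι ω '' s) := by
  let B := Module.Basis.ofVectorSpace K V
  let σ := Module.Basis.ofVectorSpaceIndex K V
  let l : V →ₗ[K] MvPolynomial σ K := B.constr K X
  let δ : V → Derivation K (MvPolynomial σ K) (MvPolynomial σ K) :=
    fun v => mkDerivation K fun i => C (ω v (B i))
  have hδl : ∀ v w, δ v (l w) = C (ω v w) := fun v w => by
    have : (δ v).toLinearMap ∘ₗ l = (Algebra.linearMap K (MvPolynomial σ K)) ∘ₗ ω v :=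
      B.ext fun i => by simp [δ, l, Module.Basis.constr_basis, mkDerivation_X, algebraMap_eq]
    exact LinearMap.congr_fun this w
  have hδδ : ∀ v w p, δ v (δ w p) = δ w (δ v p) := fun v w p => by
    have : ⁅δ v, δ w⁆ = 0 := derivation_ext fun i => by
      simp [δ, Derivation.commutator_apply, mkDerivation_X]
    have := congrArg (fun D : Derivation K (MvPolynomial σ K) (MvPolynomial σ K) => D p) this
    simpa [Derivation.commutator_apply, sub_eq_zero] using this
  let d : V →ₗ[K] Module.End K (MvPolynomial σ K) :=
    { toFun := fun v => (δ v).toLinearMap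
      map_add' := fun v w => by
        have : δ (v + w) = δ v + δ w := derivation_ext fun i => by simp [δ, mkDerivation_X]
        rw [this]; rfl
      map_smul' := fun r v => by
        have : δ (r • v) = r • δ v := derivation_ext fun i => by
          simp [δ, mkDerivation_X, smul_eq_C_mul]
        rw [this]; rfl }
  -- The Fock representation: the part $Pv$ acts by multiplication and the complementary part $v-Pv$
  -- by the derivation $\omega(v-Pv,\cdot)$.
  let f : V →ₗ[K] Module.End K (MvPolynomial σ K) :=
    LinearMap.mul K _ ∘ₗ l ∘ₗ P + d ∘ₗ (LinearMap.id - P)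
  have hf : ∀ v p, f v p = l (P v) * p + δ (v - P v) p := fun v p => rfl
  have hrel : ∀ ⦃x y⦄, WeylRel ω x y → TensorAlgebra.lift K f x = TensorAlgebra.lift K f y := by
    rintro _ _ ⟨v, w⟩
    refine LinearMap.ext fun p => ?_
    -- Only the mixed terms of $\omega$ survive, and they are the ones produced by the Leibniz rule.
    have hω : ω v w = ω (v - P v) (P w) - ω (w - P w) (P v) := by
      have e1 := h1 v w
      have e2 := h2 v w
      have e3 := hskew (w - P w) (P v)
      simp only [map_sub, LinearMap.sub_apply] at e1 e2 e3 ⊢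
      linear_combination e2 + e1 + e3
    simp only [map_mul, map_add, TensorAlgebra.lift_ι_apply, Module.End.mul_apply, hf,
      LinearMap.add_apply, AlgHom.commutes, Module.algebraMap_end_apply, hω, Derivation.leibniz,
      hδl, hδδ (v - P v), smul_eq_mul, smul_eq_C_mul, map_sub C]
    ring
  let ρ : WeylAlgebra ω →ₐ[K] Module.End K (MvPolynomial σ K) :=
    RingQuot.liftAlgHom K ⟨TensorAlgebra.lift K f, hrel⟩
  have hρ : ∀ v, ρ (WeylAlgebra.ι ω v) = f v := fun v => by
    simp [ρ, WeylAlgebra.ι]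
  have key : ∀ x ∈ Submodule.span (WeylAlgebra ω) (WeylAlgebra.ι ω '' s), ρ x 1 = 0 := by
    intro x hx
    induction hx using Submodule.span_induction with
    | mem x hx =>
      obtain ⟨v, hv, rfl⟩ := hx
      rw [hρ, hf, hs v hv, map_zero, zero_mul, zero_add]
      exact Derivation.map_one_eq_zero _
    | zero => rw [map_zero]; rfl
    | add x y _ _ hx hy => rw [map_add, LinearMap.add_apply, hx, hy, add_zero]
    | smul a x _ hx => rw [smul_eq_mul, map_mul, Module.End.mul_apply, hx, map_zero]
  intro h
  have := key 1 h
  rw [map_one ρ, Module.End.one_apply] at this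
  exact one_ne_zero this

/-- If `Q` vanishes on the image and on the kernel of a projection `P`, then the kernel of `P`
generates a proper left ideal of the Clifford algebra: it annihilates `1` in the exterior
representation. -/
lemma one_notMem_cliffordIdeal (Q : QuadraticForm K V) (P : V →ₗ[K] V)
    (h1 : ∀ v, Q (P v) = 0) (h2 : ∀ v, Q (v - P v) = 0) {s : Set V} (hs : ∀ v ∈ s, P v = 0) :
    (1 : CliffordAlgebra Q) ∉
      Submodule.span (CliffordAlgebra Q) (CliffordAlgebra.ι Q '' s) := by
  -- The exterior analogue: $Pv$ acts by left multiplication and $v-Pv$ by contraction. Both square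
  -- to zero, and their anticommutator is the polar form of $v-Pv$ and $Pv$, which equals $Q(v)$.
  let f : V →ₗ[K] Module.End K (ExteriorAlgebra K V) :=
    LinearMap.mul K _ ∘ₗ ExteriorAlgebra.ι K ∘ₗ P +
      CliffordAlgebra.contractLeft ∘ₗ Q.polarBilin ∘ₗ (LinearMap.id - P)
  have hf : ∀ v x, f v x = ExteriorAlgebra.ι K (P v) * x +
      CliffordAlgebra.contractLeft (Q.polarBilin (v - P v)) x := fun v x => rfl
  have hrel : ∀ v, f v * f v = algebraMap K _ (Q v) := fun v => by
    refine LinearMap.ext fun x => ?_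
    have hQ : Q.polarBilin (v - P v) (P v) = Q v := by
      rw [QuadraticMap.polarBilin_apply_apply, QuadraticMap.polar, sub_add_cancel, h1, h2]
      simp
    have hι : ∀ y, CliffordAlgebra.contractLeft (Q.polarBilin (v - P v))
        (ExteriorAlgebra.ι K (P v) * y) = Q.polarBilin (v - P v) (P v) • y -
          ExteriorAlgebra.ι K (P v) * CliffordAlgebra.contractLeft (Q.polarBilin (v - P v)) y :=
      fun y => CliffordAlgebra.contractLeft_ι_mul _ _ y
    rw [Module.End.mul_apply, hf, hf, map_add, hι, hQ, CliffordAlgebra.contractLeft_contractLeft,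
      mul_add, ← mul_assoc, ExteriorAlgebra.ι_sq_zero, Module.algebraMap_end_apply]
    simp
  let ρ := CliffordAlgebra.lift Q ⟨f, hrel⟩
  have key : ∀ x ∈ Submodule.span (CliffordAlgebra Q) (CliffordAlgebra.ι Q '' s), ρ x 1 = 0 := by
    intro x hx
    induction hx using Submodule.span_induction with
    | mem x hx =>
      obtain ⟨v, hv, rfl⟩ := hx
      rw [CliffordAlgebra.lift_ι_apply, hf, hs v hv, map_zero, zero_mul, zero_add]
      exact CliffordAlgebra.contractLeft_one _ _
    | zero => rw [map_zero]; rfl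
    | add x y _ _ hx hy => rw [map_add, LinearMap.add_apply, hx, hy, add_zero]
    | smul a x _ hx => rw [smul_eq_mul, map_mul, Module.End.mul_apply, hx, map_zero]
  intro h
  have := key 1 h
  rw [map_one ρ, Module.End.one_apply] at this
  exact one_ne_zero this

end Polarization

section Vacuum

variable (K : Type*) [Field K] (ℓ : Type*) [LieRing ℓ] [LieAlgebra K ℓ]

/-- The projection of the loop algebra onto its part of negative degree. -/
noncomputable def loopNegative : Loop K ℓ →ₗ[K] Loop K ℓ :=
  (LieAlgebra.LoopAlgebra.toFinsupp K ℤ ℓ).symm.toLinearMap ∘ₗ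
    (Finsupp.lsum K fun n : ℤ => if n ≤ -1 then Finsupp.lsingle n else 0) ∘ₗ
      (LieAlgebra.LoopAlgebra.toFinsupp K ℤ ℓ).toLinearMap

/-- The projection of the restricted dual onto its part of non-positive degree. -/
noncomputable def dualNonpositive : RestrictedDual K ℓ →ₗ[K] RestrictedDual K ℓ :=
  (RestrictedDual.toFinsupp K ℓ).symm.toLinearMap ∘ₗ
    (Finsupp.lsum K fun n : ℤ => if n ≤ 0 then Finsupp.lsingle n else 0) ∘ₗ
      (RestrictedDual.toFinsupp K ℓ).toLinearMap

variable {K ℓ}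

lemma loopNegative_loopMode (n : ℤ) (u : ℓ) :
    loopNegative K ℓ (loopMode K n u) = if n ≤ -1 then loopMode K n u else 0 := by
  simp only [loopNegative, loopMode, LinearMap.comp_apply, LinearEquiv.coe_coe,
    LieAlgebra.LoopAlgebra.toFinsupp_single_tmul, Finsupp.lsum_single]
  split_ifs <;> simp

lemma dualNonpositive_dualMode (n : ℤ) (f : Module.Dual K ℓ) :
    dualNonpositive K ℓ (dualMode n f) = if n ≤ 0 then dualMode n f else 0 := by
  simp only [dualNonpositive, dualMode, LinearMap.comp_apply, LinearEquiv.coe_coe,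
    LinearEquiv.apply_symm_apply, Finsupp.lsum_single]
  split_ifs <;> simp

lemma pairing_creation (f : RestrictedDual K ℓ) (x : Loop K ℓ) :
    pairing K ℓ (dualNonpositive K ℓ f) (loopNegative K ℓ x) = 0 := by
  induction f using restrictedDual_induction with
  | h0 => simp
  | hadd f g hf hg => rw [map_add, map_add, LinearMap.add_apply, hf, hg, add_zero]
  | hmode n f =>
    induction x using loop_induction with
    | h0 => simp
    | hadd x y hx hy => rw [map_add, map_add, hx, hy, add_zero]
    | hmode m u =>
      rw [loopNegative_loopMode, dualNonpositive_dualMode]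
      split_ifs
      · rw [pairing_modes, if_neg (by omega)]
      all_goals simp

lemma pairing_annihilation (f : RestrictedDual K ℓ) (x : Loop K ℓ) :
    pairing K ℓ (f - dualNonpositive K ℓ f) (x - loopNegative K ℓ x) = 0 := by
  induction f using restrictedDual_induction with
  | h0 => simp
  | hadd f g hf hg => rw [map_add, add_sub_add_comm, map_add, LinearMap.add_apply, hf, hg, add_zero]
  | hmode n f =>
    induction x using loop_induction with
    | h0 => simp
    | hadd x y hx hy => rw [map_add, add_sub_add_comm, map_add, hx, hy, add_zero]
    | hmode m u =>
      rw [loopNegative_loopMode, dualNonpositive_dualMode]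
      split_ifs
      · simp
      · simp
      · simp
      · rw [sub_zero, sub_zero, pairing_modes, if_neg (by omega)]

variable (K ℓ) in
/-- The projection onto the span of the vectors that give creation operators. -/
noncomputable def creationPart : Double K ℓ →ₗ[K] Double K ℓ :=
  (loopNegative K ℓ).prodMap (dualNonpositive K ℓ)

lemma creationPart_of_mem {v : Double K ℓ} (hv : v ∈ annihilationVectors K ℓ) :
    creationPart K ℓ v = 0 := by
  rcases hv with ⟨n, hn, u, rfl⟩ | ⟨n, hn, f, rfl⟩
  · rw [creationPart, LinearMap.prodMap_apply, loopNegative_loopMode, if_neg (by omega), map_zero]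
    rfl
  · rw [creationPart, LinearMap.prodMap_apply, dualNonpositive_dualMode, if_neg (by omega),
      map_zero]
    rfl

lemma vacuum_ne_zero : vacuum K ℓ ≠ 0 := by
  have hs : (symIdeal K ℓ).mkQ 1 ≠ 0 := by
    rw [Submodule.mkQ_apply, Ne, Submodule.Quotient.mk_eq_zero]
    refine one_notMem_weylIdeal (symplecticForm K ℓ) (creationPart K ℓ) (fun v w => ?_)
      (fun v w => ?_) (fun v w => ?_) fun v => creationPart_of_mem
    · simp [symplecticForm, creationPart, pairing_creation]
    · simp only [symplecticForm, creationPart, LinearMap.sub_apply, LinearMap.flip_apply,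
        halfForm_apply, Prod.fst_sub, Prod.snd_sub, LinearMap.prodMap_apply, pairing_annihilation,
        sub_self]
    · simp [symplecticForm]
  have he : (extIdeal K ℓ).mkQ 1 ≠ 0 := by
    rw [Submodule.mkQ_apply, Ne, Submodule.Quotient.mk_eq_zero]
    have hq : ∀ v, quadForm K ℓ v = pairing K ℓ v.2 v.1 := fun v => rfl
    refine one_notMem_cliffordIdeal (quadForm K ℓ) (creationPart K ℓ) (fun v => ?_)
      (fun v => ?_) fun v => creationPart_of_mem
    · rw [hq]
      exact pairing_creation _ _
    · rw [hq]
      exact pairing_annihilation _ _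
  intro h
  -- Over a field, functionals that are non-zero on the two factors show that their tensor product
  -- is non-zero.
  obtain ⟨φ, hφ⟩ := not_forall.1 (mt (Module.forall_dual_apply_eq_zero_iff K _).1 hs)
  obtain ⟨ψ, hψ⟩ := not_forall.1 (mt (Module.forall_dual_apply_eq_zero_iff K _).1 he)
  have h2 := congrArg (TensorProduct.lid K K ∘ TensorProduct.map φ ψ) h
  rw [vacuum, Function.comp_apply, TensorProduct.map_tmul, TensorProduct.lid_tmul,
    Function.comp_apply, map_zero, map_zero] at h2
  exact (smul_eq_zero.1 h2).elim hφ hψ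

end Vacuum

/-- If every element of `ker D` is, modulo `im D`, a unique multiple of `v`, then the cohomology of
`D` is the line of the class of `v`. -/
lemma exists_cohomology_equiv {K : Type*} [Field K] {M : Type*} [AddCommGroup M] [Module K M]
    {D : Module.End K M} {v : M} (hv : v ∈ LinearMap.ker D)
    (hspan : ∀ x, D x = 0 → ∃ (z : M) (r : K), x = D z + r • v) (hne : ∀ z, D z ≠ v) :
    ∃ φ : Cohomology D ≃ₗ[K] K, φ (Submodule.Quotient.mk ⟨v, hv⟩) = 1 := by
  let q : LinearMap.ker D →ₗ[K] Cohomology D :=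
    ((LinearMap.range D).submoduleOf (LinearMap.ker D)).mkQ
  have hq : ∀ x, q x = 0 ↔ ∃ z, D z = x := fun x =>
    (Submodule.Quotient.mk_eq_zero _).trans Iff.rfl
  let g : K →ₗ[K] Cohomology D := q ∘ₗ LinearMap.toSpanSingleton K _ ⟨v, hv⟩
  have hinj : Function.Injective g := by
    rw [← LinearMap.ker_eq_bot, LinearMap.ker_eq_bot']
    intro r hr
    by_contra h0
    obtain ⟨z, hz⟩ := (hq _).1 hr
    refine hne (r⁻¹ • z) ?_
    rw [map_smul, hz]
    change r⁻¹ • r • v = v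
    rw [smul_smul, inv_mul_cancel₀ h0, one_smul]
  have hsurj : Function.Surjective g := by
    intro y
    obtain ⟨⟨x, hx⟩, rfl⟩ := Submodule.Quotient.mk_surjective _ y
    obtain ⟨z, r, h⟩ := hspan x hx
    refine ⟨r, ?_⟩
    change q (r • ⟨v, hv⟩) = q ⟨x, hx⟩
    rw [eq_comm, ← sub_eq_zero, ← map_sub, hq]
    refine ⟨z, ?_⟩
    change D z = x - r • v
    rw [h, add_sub_cancel_right]
  refine ⟨(LinearEquiv.ofBijective g ⟨hinj, hsurj⟩).symm, ?_⟩
  rw [LinearEquiv.symm_apply_eq]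
  exact congrArg q (one_smul K _).symm

end VOWA

theorem proposition4 {K : Type*} [Field K] [IsAlgClosed K] [CharZero K]
    {ℓ : Type*} [LieRing ℓ] [LieAlgebra K ℓ] [FiniteDimensional K ℓ]
    {ι : Type*} [Finite ι] (e : Module.Basis ι K ℓ) :
    (VOWA.Q e + VOWA.koszul e) * (VOWA.Q e + VOWA.koszul e) = 0 ∧
    ∃ h1 : VOWA.vacuum K ℓ ∈ LinearMap.ker (VOWA.Q e + VOWA.koszul e),
    ∃ φ : VOWA.Cohomology (VOWA.Q e + VOWA.koszul e) ≃ₗ[K] K,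
      φ (Submodule.Quotient.mk ⟨VOWA.vacuum K ℓ, h1⟩) = 1 := by
  rw [VOWA.Q_add_koszul_eq]
  obtain ⟨h2, h3⟩ := (VOWA.weilRep K ℓ).homology_total e
  exact ⟨LinearMap.ext ((VOWA.weilRep K ℓ).total_total e), (VOWA.weilRep K ℓ).total_vac e,
    VOWA.exists_cohomology_equiv _ h2 (h3 VOWA.vacuum_ne_zero)⟩
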